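/- Let $n\ge 1$ and $0<\tau<\beta$, and consider in $\mathbb R^n$ the Cauchy problem $$\tau u_{ttt}+u_{tt}-\Delta u-\beta\Delta u_t=0\quad(t>0),\qquad u(0)=u_0,\quad u_t(0)=u_1,\quad u_{tt}(0)=u_2,$$ with $u_0,u_1,u_2\in\mathcal S'(\mathbb R^n)$. A solution is a function $u:[0,\infty)\to\mathcal S'(\mathbb R^n)$ with $u,u_t,u_{tt}$ (weak-*) continuous on $[0,\infty)$ that satisfies the equation for $t>0$, the derivatives in time being taken in the weak-* sense. Put $$\mathbf V=\big(u_t+\tau u_{tt},\ \nabla(u+\tau u_t),\ \nabla u_t\big),\qquad \mathbf V_0=\mathbf V(0).$$ Let $\chi,\varphi:\mathbb R^n\to[0,1]$ be smooth with $\operatorname{supp}\chi\subset\{|\xi|\le\frac43\}$, $\operatorname{supp}\varphi\subset\{\frac34\le|\xi|\le\frac83\}$, $\chi(\xi)+\sum_{q\ge0}\varphi(2^{-q}\xi)=1$ for all $\xi$, and $\sum_{q\in\mathbb Z}\varphi(2^{-q}\xi)=1$ for $\xi\ne0$. For $f\in\mathcal S'(\mathbb R^n)$ let $\dot\Delta_qf=\varphi(2^{-q}D)f$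 for $q\in\mathbb Z$, and let $\Delta_{-1}f=\chi(D)f$ and $\Delta_qf=\dot\Delta_qf$ for $q\ge0$, where $m(D)$ is multiplication by $m(\xi)$ on the side of the Fourier transform $\hat f(\xi)=\int e^{-ix\cdot\xi}f(x)\,dx$. For $r\in\mathbb R$ set $$\|f\|_{\dot B^r_{2,1}}=\sum_{q\in\mathbb Z}2^{qr}\|\dot\Delta_qf\|_{L^2},\qquad \|f\|_{\dot B^r_{2,\infty}}=\sup_{q\in\mathbb Z}2^{qr}\|\dot\Delta_qf\|_{L^2},\qquad \|f\|_{B^r_{2,1}}=\sum_{q\ge-1}2^{qr}\|\Delta_qf\|_{L^2}.$$ The $\dot B$ norms do not see polynomials, and $f\in\dot B$ means that the norm is finite. Norms of vectors are sums over the components, and $\|\cdot\|_{\dot B^{\sigma}_{2,1}\cap\dot B^{-s}_{2,\infty}}=\|\cdot\|_{\dot B^{\sigma}_{2,1}}+\|\cdot\|_{\dot B^{-s}_{2,\infty}}$. For $k\ge0$ and $f$ whose Fourier transform is a function, $\Lambda^kf$ is defined by $\widehat{\Lambda^kf}=|\xi|^k\hat f$. **(a)** Let $\sigma,s\in\mathbb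 R$ with $\sigma+s>0$. There is a constant $C>0$, depending only on $n,\tau,\beta,\varphi,\chi,\sigma,s$, such that for every solution with $\mathbf V_0\in\dot B^\sigma_{2,1}\cap\dot B^{-s}_{2,\infty}$ and all $t\ge0$, $$\|\mathbf V(t)\|_{\dot B^\sigma_{2,1}}\le C\,\|\mathbf V_0\|_{\dot B^\sigma_{2,1}\cap\dot B^{-s}_{2,\infty}}\,(1+t)^{-\frac{\sigma+s}2}.$$ **(b)** Let $\sigma\ge0$ and $s>0$. There is a constant $C>0$, depending only on $n,\tau,\beta,\varphi,\chi,\sigma,s$, such that for every solution with $\mathbf V_0\in\dot B^\sigma_{2,1}\cap\dot B^{-s}_{2,\infty}$ and $\mathbf V_0=\sum_{q\in\mathbb Z}\dot\Delta_q\mathbf V_0$ in $\mathcal S'$ (that is, $\mathbf V_0$ is the representative, in its class modulo polynomials, without polynomial part), for all real $k$ with $0\le k\le\sigma$ and all $t\ge0$, $\Lambda^k\mathbf V(t)$ is defined and $$\|\Lambda^k\mathbf V(t)\|_{B^{\sigma-k}_{2,1}}\le C\,\|\mathbf V_0\|_{\dot B^\sigma_{2,1}\cap\dot B^{-s}_{2,\infty}}\,(1+t)^{-\frac{k+s}2}.$$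 -/

import Mathlib

open MeasureTheory Filter Topology
open scoped ENNReal ContDiff SchwartzMap FourierTransform LineDeriv Laplacian

noncomputable section

/-- The Euclidean space `ℝⁿ`. -/
abbrev Rn (n : ℕ) : Type := EuclideanSpace ℝ (Fin n)

/-- Complex-valued tempered distributions on `ℝⁿ` (with the weak-* topology). -/
abbrev TDist (n : ℕ) : Type := 𝓢'(Rn n, ℂ)

/-- A pair `(φ, χ)` of smooth cut-off functions giving the Littlewood-Paley decomposition. -/
structure LPPair (n : ℕ) where
  φ : Rn n → ℝ
  χ : Rn n → ℝ
  φ_smooth : ContDiff ℝ ∞ φ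
  χ_smooth : ContDiff ℝ ∞ χ
  φ_mem : ∀ ξ, φ ξ ∈ Set.Icc (0 : ℝ) 1
  χ_mem : ∀ ξ, χ ξ ∈ Set.Icc (0 : ℝ) 1
  φ_supp : Function.support φ ⊆ {ξ | 3 / 4 ≤ ‖ξ‖ ∧ ‖ξ‖ ≤ 8 / 3}
  χ_supp : Function.support χ ⊆ {ξ | ‖ξ‖ ≤ 4 / 3}
  sum_inhom : ∀ ξ, HasSum (fun q : ℕ => φ ((2 : ℝ) ^ (-(q : ℤ)) • ξ)) (1 - χ ξ)
  sum_hom : ∀ ξ, ξ ≠ 0 → HasSum (fun q : ℤ => φ ((2 : ℝ) ^ (-q) • ξ)) 1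

/-- The operator `m(D)` of multiplication by `m(ξ)` on the side of the Fourier transform
`∫ e^{-i x·ξ} f(x) dx`.  Mathlib's transform is `∫ e^{-2πi x·ξ} f(x) dx`, so that its variable `ξ`
stands for the angular frequency `2πξ`. -/
def multD {n : ℕ} (m : Rn n → ℝ) : TDist n →L[ℂ] TDist n :=
  TemperedDistribution.fourierMultiplierCLM ℂ
    (fun ξ : Rn n => ((m ((2 * Real.pi) • ξ) : ℝ) : ℂ))

/-- The dyadic block `φ(2^{-q} D) f`, for `q ∈ ℤ`. -/
def LPPair.block {n : ℕ} (P : LPPair n) (q : ℤ) (f : TDist n) : TDist n :=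
  multD (fun ξ => P.φ ((2 : ℝ) ^ (-q) • ξ)) f

/-- The low-frequency block `χ(D) f`. -/
def LPPair.lowBlock {n : ℕ} (P : LPPair n) (f : TDist n) : TDist n :=
  multD P.χ f

/-- The `L²` norm of a tempered distribution, equal to `∞` if the distribution is not (given by)
a square integrable function. -/
def l2norm {n : ℕ} (f : TDist n) : ℝ≥0∞ :=
  ⨅ (g : Lp ℂ 2 (volume : Measure (Rn n))) (_ : (g : TDist n) = f), ‖g‖ₑ

/-- The norm of the homogeneous Besov space `Ḃ^σ_{2,1}`.  It does not change when a polynomial is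
added to `f`; the class of `f` modulo polynomials lies in the space iff the value is finite. -/
def LPPair.homNormOne {n : ℕ} (P : LPPair n) (σ : ℝ) (f : TDist n) : ℝ≥0∞ :=
  ∑' q : ℤ, ENNReal.ofReal ((2 : ℝ) ^ ((q : ℝ) * σ)) * l2norm (P.block q f)

/-- The norm of the homogeneous Besov space `Ḃ^σ_{2,∞}`. -/
def LPPair.homNormInf {n : ℕ} (P : LPPair n) (σ : ℝ) (f : TDist n) : ℝ≥0∞ :=
  ⨆ q : ℤ, ENNReal.ofReal ((2 : ℝ) ^ ((q : ℝ) * σ)) * l2norm (P.block q f)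

/-- The norm of the inhomogeneous Besov space `B^σ_{2,1}`; the first term is that of `q = -1`. -/
def LPPair.normOne {n : ℕ} (P : LPPair n) (σ : ℝ) (f : TDist n) : ℝ≥0∞ :=
  ENNReal.ofReal ((2 : ℝ) ^ (-σ)) * l2norm (P.lowBlock f) +
    ∑' q : ℕ, ENNReal.ofReal ((2 : ℝ) ^ ((q : ℝ) * σ)) * l2norm (P.block (q : ℤ) f)

/-- `f = ∑_{q ∈ ℤ} φ(2^{-q} D) f` in the sense of tempered distributions: `f` is the representative
without polynomial part of its class modulo polynomials. -/
def LPPair.IsRealized {n : ℕ} (P : LPPair n) (f : TDist n) : Prop :=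
  Tendsto (fun N : ℕ => ∑ q ∈ Finset.Icc (-(N : ℤ)) N, P.block q f) atTop (𝓝 f)

/-- `g = Λ^k f`: the Fourier transform of `f` is a function `F`, and that of `g` is the function
`|ξ|^k F` (at the angular frequency `2πξ`). -/
def IsLambdaPow {n : ℕ} (k : ℝ) (f g : TDist n) : Prop :=
  ∃ F : Rn n → ℂ, ∀ ψ : 𝓢(Rn n, ℂ),
    (Integrable (fun ξ => ψ ξ * F ξ) ∧ (𝓕 f) ψ = ∫ ξ, ψ ξ * F ξ) ∧
    (Integrable (fun ξ => ψ ξ * (((‖(2 * Real.pi) • ξ‖ ^ k : ℝ) : ℂ) * F ξ)) ∧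
      (𝓕 g) ψ = ∫ ξ, ψ ξ * (((‖(2 * Real.pi) • ξ‖ ^ k : ℝ) : ℂ) * F ξ))

/-- `u` is a solution, on `t ≥ 0` and with values in the tempered distributions, of the Cauchy
problem `τ u_ttt + u_tt - Δ u - β Δ u_t = 0`, `u(0) = u₀`, `u_t(0) = u₁`, `u_tt(0) = u₂`, and
`v = u_t`, `w = u_tt`.  Continuity and derivatives in time are those of the weak-* topology, that
is, they are tested against each Schwartz function. -/
structure IsMGTSolution {n : ℕ} (τ β : ℝ) (u₀ u₁ u₂ : TDist n) (u v w : ℝ → TDist n) : Prop where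
  init_u : u 0 = u₀
  init_v : v 0 = u₁
  init_w : w 0 = u₂
  cont_u : ∀ ψ : 𝓢(Rn n, ℂ), ContinuousOn (fun t => u t ψ) (Set.Ici 0)
  cont_v : ∀ ψ : 𝓢(Rn n, ℂ), ContinuousOn (fun t => v t ψ) (Set.Ici 0)
  cont_w : ∀ ψ : 𝓢(Rn n, ℂ), ContinuousOn (fun t => w t ψ) (Set.Ici 0)
  deriv_u : ∀ ψ : 𝓢(Rn n, ℂ), ∀ t : ℝ, 0 < t → HasDerivAt (fun r => u r ψ) (v t ψ) t
  deriv_v : ∀ ψ : 𝓢(Rn n, ℂ), ∀ t : ℝ, 0 < t → HasDerivAt (fun r => v r ψ) (w t ψ) t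
  /-- `τ w_t + w - Δ u - β Δ v = 0`, solved for the time derivative of `τ w` -/
  deriv_w : ∀ ψ : 𝓢(Rn n, ℂ), ∀ t : ℝ, 0 < t →
    HasDerivAt (fun r => (τ : ℂ) * w r ψ) ((Δ (u t) + (β : ℂ) • Δ (v t) - w t) ψ) t

/-- The index set of the components of the vector `(u_t + τ u_tt, ∇(u + τ u_t), ∇ u_t)`. -/
abbrev VIdx (n : ℕ) : Type := Unit ⊕ Fin n ⊕ Fin n

/-- The vector `V = (v + τ w, ∇(u + τ v), ∇ v)`, component by component. -/
def mgtVector {n : ℕ} (τ : ℝ) (u v w : TDist n) : VIdx n → TDist n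
  | Sum.inl _ => v + (τ : ℂ) • w
  | Sum.inr (Sum.inl j) => ∂_{EuclideanSpace.single j (1 : ℝ)} (u + (τ : ℂ) • v)
  | Sum.inr (Sum.inr j) => ∂_{EuclideanSpace.single j (1 : ℝ)} v

/-- The norm of a vector in `Ḃ^σ_{2,1} ∩ Ḃ^{-s}_{2,∞}`; norms of vectors are sums over the
components. -/
def LPPair.dataNorm {n : ℕ} (P : LPPair n) (σ s : ℝ) (V : VIdx n → TDist n) : ℝ≥0∞ :=
  (∑ i, P.homNormOne σ (V i)) + ∑ i, P.homNormInf (-s) (V i)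

end

noncomputable section

section SchwartzSeries

variable {E : Type*} [NormedAddCommGroup E] [NormedSpace ℝ E]

/-- A series of Schwartz functions converges in the Schwartz space as soon as all the series of
seminorms converge. -/
theorem SchwartzMap.exists_tendsto_sum_of_summable_seminorm (η : ℕ → 𝓢(E, ℂ))
    (hη : ∀ k l, Summable fun m => SchwartzMap.seminorm ℂ k l (η m)) :
    ∃ S : 𝓢(E, ℂ), Tendsto (fun N => ∑ i ∈ Finset.range N, η i) atTop (𝓝 S) := by
  have hsm : ∀ i, ContDiff ℝ ∞ (η i : E → ℂ) := fun i => (η i).smooth ⊤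
  have hb : ∀ (k : ℕ) (i : ℕ) (x : E), ‖iteratedFDeriv ℝ k (η i) x‖ ≤
      SchwartzMap.seminorm ℂ 0 k (η i) := fun k i x =>
    SchwartzMap.norm_iteratedFDeriv_le_seminorm ℂ (η i) k x
  have hD : ∀ (k : ℕ) (x : E), iteratedFDeriv ℝ k (fun y => ∑' i, η i y) x =
      ∑' i, iteratedFDeriv ℝ k (η i) x := fun k x =>
    iteratedFDeriv_tsum_apply (N := ⊤) (v := fun k i => SchwartzMap.seminorm ℂ 0 k (η i)) hsm
      (fun k _ => hη 0 k) (fun k i x _ => hb k i x) le_top x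
  have hsx : ∀ (k : ℕ) (x : E), Summable fun i => iteratedFDeriv ℝ k (η i) x := fun k x =>
    Summable.of_norm_bounded (hη 0 k) (fun i => hb k i x)
  have hw : ∀ (k l : ℕ) (x : E) (i : ℕ), ‖x‖ ^ k * ‖iteratedFDeriv ℝ l (η i) x‖ ≤
      SchwartzMap.seminorm ℂ k l (η i) := fun k l x i => SchwartzMap.le_seminorm ℂ k l (η i) x
  have hwt : ∀ (k l : ℕ) (x : E) (f : ℕ → ℕ), Function.Injective f →
      ‖x‖ ^ k * ‖∑' i, iteratedFDeriv ℝ l (η (f i)) x‖ ≤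
        ∑' i, SchwartzMap.seminorm ℂ k l (η (f i)) := by
    intro k l x f hf
    have h1 : Summable fun i => ‖x‖ ^ k * ‖iteratedFDeriv ℝ l (η (f i)) x‖ :=
      Summable.of_nonneg_of_le (fun i => by positivity) (fun i => hw k l x (f i))
        ((hη k l).comp_injective hf)
    have h2 : Summable fun i => ‖iteratedFDeriv ℝ l (η (f i)) x‖ :=
      Summable.of_nonneg_of_le (fun i => norm_nonneg _) (fun i => hb l (f i) x)
        ((hη 0 l).comp_injective hf)
    calc ‖x‖ ^ k * ‖∑' i, iteratedFDeriv ℝ l (η (f i)) x‖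
        ≤ ‖x‖ ^ k * ∑' i, ‖iteratedFDeriv ℝ l (η (f i)) x‖ := by
          gcongr; exact norm_tsum_le_tsum_norm h2
      _ = ∑' i, ‖x‖ ^ k * ‖iteratedFDeriv ℝ l (η (f i)) x‖ := by rw [tsum_mul_left]
      _ ≤ _ := h1.tsum_le_tsum (fun i => hw k l x (f i)) ((hη k l).comp_injective hf)
  let S : 𝓢(E, ℂ) :=
    { toFun := fun y => ∑' i, η i y
      smooth' := contDiff_tsum (N := ⊤) (v := fun k i => SchwartzMap.seminorm ℂ 0 k (η i)) hsm
        (fun k _ => hη 0 k) (fun k i x _ => hb k i x)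
      decay' := fun k l => ⟨∑' i, SchwartzMap.seminorm ℂ k l (η i), fun x => by
        rw [hD]; exact hwt k l x id Function.injective_id⟩ }
  refine ⟨S, ?_⟩
  rw [(schwartz_withSeminorms ℂ E ℂ).tendsto_nhds]
  rintro ⟨k, l⟩ ε hε
  have htail := tendsto_sum_nat_add fun m => SchwartzMap.seminorm ℂ k l (η m)
  filter_upwards [htail.eventually_lt_const hε] with N hN
  refine lt_of_le_of_lt ?_ hN
  rw [SchwartzMap.schwartzSeminormFamily_apply, map_sub_rev]
  refine SchwartzMap.seminorm_le_bound ℂ k l _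
    (tsum_nonneg fun i => apply_nonneg _ _) fun x => ?_
  have hcoe : (⇑(S - ∑ i ∈ Finset.range N, η i) : E → ℂ) = fun y => ∑' i, η (i + N) y := by
    funext y
    have hy : Summable fun i => η i y :=
      Summable.of_norm_bounded (hη 0 0) (fun i => SchwartzMap.norm_le_seminorm ℂ (η i) y)
    have := hy.sum_add_tsum_nat_add N
    simp only [sub_apply, sum_apply]
    rw [sub_eq_iff_eq_add', this]
    rfl
  rw [hcoe]
  have hD' : iteratedFDeriv ℝ l (fun y => ∑' i, η (i + N) y) x =
      ∑' i, iteratedFDeriv ℝ l (η (i + N)) x :=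
    iteratedFDeriv_tsum_apply (N := ⊤) (v := fun k i => SchwartzMap.seminorm ℂ 0 k (η (i + N)))
      (fun i => hsm _) (fun k _ => (hη 0 k).comp_injective (add_left_injective N))
      (fun k i x _ => hb k _ x) le_top x
  rw [hD']
  exact hwt k l x (fun i => i + N) (add_left_injective N)

/-- A pointwise bounded family of tempered distributions is uniformly bounded along a sequence of
Schwartz functions all of whose seminorms are summable. -/
theorem TemperedDistribution.exists_uniform_bound {ι : Type*} (L : ι → 𝓢'(E, ℂ))
    (hL : ∀ ψ : 𝓢(E, ℂ), ∃ C, ∀ s, ‖L s ψ‖ ≤ C) (η : ℕ → 𝓢(E, ℂ))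
    (hη : ∀ k l, Summable fun m => SchwartzMap.seminorm ℂ k l (η m)) :
    ∃ C, ∀ s m, ‖L s (η m)‖ ≤ C := by
  have hsum : ∀ s, Summable fun m => ‖L s (η m)‖ := by
    intro s
    obtain ⟨t, C, -, hC⟩ := Seminorm.bound_of_continuous (schwartz_withSeminorms ℂ E ℂ)
      ((normSeminorm ℂ ℂ).comp (L s).toLinearMap) (continuous_norm.comp (L s).continuous)
    refine Summable.of_nonneg_of_le (fun _ => norm_nonneg _) (fun m => hC (η m)) ?_
    refine Summable.mul_left (C : ℝ) ?_
    refine Summable.of_nonneg_of_le (fun _ => apply_nonneg _ _)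
      (fun m => Seminorm.finset_sup_le_sum (schwartzSeminormFamily ℂ E ℂ) t (η m)) ?_
    simp only [← FunLike.coeAddMonoidHom_apply, map_sum, Finset.sum_apply]
    exact summable_sum fun i _ => hη i.1 i.2
  have hmem : ∀ s, Memℓp (fun m => (starRingEnd ℂ) (L s (η m))) 2 := fun s => by
    refine memℓp_gen ?_
    simp only [RCLike.norm_conj, ENNReal.toReal_ofNat, Real.rpow_ofNat]
    obtain ⟨M, hM⟩ := (hsum s).tendsto_atTop_zero.bddAbove_range
    refine Summable.of_nonneg_of_le (fun _ => by positivity) (fun m => ?_) ((hsum s).mul_left M)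
    rw [sq]
    gcongr
    exact hM ⟨m, rfl⟩
  let b : ι → lp (fun _ : ℕ => ℂ) 2 := fun s => ⟨_, hmem s⟩
  have hbd : ∀ a : lp (fun _ : ℕ => ℂ) 2, ∃ C, ∀ s, ‖innerSL ℂ (b s) a‖ ≤ C := by
    intro a
    obtain ⟨S, hS⟩ := SchwartzMap.exists_tendsto_sum_of_summable_seminorm (fun m => a m • η m)
      (fun k l => by
        refine Summable.of_nonneg_of_le (fun _ => apply_nonneg _ _) (fun m => ?_)
          ((hη k l).mul_left ‖a‖)
        rw [map_smul_eq_mul]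
        gcongr
        exact lp.norm_apply_le_norm (by norm_num) a m)
    obtain ⟨C, hC⟩ := hL S
    refine ⟨C, fun s => ?_⟩
    have h1 := (lp.hasSum_inner (𝕜 := ℂ) (b s) a).tendsto_sum_nat
    have h2 := ((L s).continuous.tendsto S).comp hS
    have h3 : innerSL ℂ (b s) a = L s S := by
      refine tendsto_nhds_unique (l := atTop)
        (f := fun N => ∑ i ∈ Finset.range N, L s (a i • η i)) ?_ ?_
      · refine h1.congr fun N => Finset.sum_congr rfl fun i _ => ?_
        simp [b]
      · exact h2.congr fun N => map_sum (L s) _ _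
    rw [h3]
    exact hC s
  obtain ⟨C, hC⟩ := banach_steinhaus hbd
  refine ⟨C, fun s m => ?_⟩
  have h1 := lp.norm_apply_le_norm (by norm_num) (b s) m
  have h2 := hC s
  rw [innerSL_apply_norm] at h2
  have h3 : ‖b s m‖ = ‖L s (η m)‖ := RCLike.norm_conj _
  linarith

/-- The sum of the Schwartz seminorms with a given weight, up to a given order of derivatives. -/
def SchwartzMap.seminormUpTo (k l : ℕ) (ψ : 𝓢(E, ℂ)) : ℝ :=
  ∑ j ∈ Finset.range (l + 1), SchwartzMap.seminorm ℂ k j ψ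

theorem SchwartzMap.seminorm_le_seminormUpTo (k : ℕ) {j l : ℕ} (h : j ≤ l) (ψ : 𝓢(E, ℂ)) :
    SchwartzMap.seminorm ℂ k j ψ ≤ SchwartzMap.seminormUpTo k l ψ :=
  Finset.single_le_sum (f := fun j => SchwartzMap.seminorm ℂ k j ψ)
    (fun _ _ => apply_nonneg _ _) (by simpa [Nat.lt_succ_iff] using h)

theorem SchwartzMap.seminormUpTo_nonneg (k l : ℕ) (ψ : 𝓢(E, ℂ)) :
    0 ≤ SchwartzMap.seminormUpTo k l ψ := Finset.sum_nonneg fun _ _ => apply_nonneg _ _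

theorem SchwartzMap.seminormUpTo_sum_le {ι : Type*} (s : Finset ι) (k l : ℕ) (ψ : ι → 𝓢(E, ℂ)) :
    SchwartzMap.seminormUpTo k l (∑ i ∈ s, ψ i) ≤
      ∑ i ∈ s, SchwartzMap.seminormUpTo k l (ψ i) := by
  unfold SchwartzMap.seminormUpTo
  rw [Finset.sum_comm]
  refine Finset.sum_le_sum fun j _ => ?_
  exact Finset.le_sum_of_subadditive _ (map_zero _).le (fun x y => map_add_le_add _ x y) s ψ

/-- The Leibniz rule, with a bound on the derivatives of the first factor that is valid where the
derivatives of the second one do not vanish. -/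
theorem SchwartzMap.pow_mul_norm_iteratedFDeriv_mul_le {g : E → ℂ} (hg : ContDiff ℝ ∞ g)
    (ψ : 𝓢(E, ℂ)) (k l : ℕ) (A : ℝ) (hA : 0 ≤ A) (x : E)
    (h : x ∈ tsupport ψ → ∀ j ≤ l, ‖iteratedFDeriv ℝ j g x‖ ≤ A) :
    ‖x‖ ^ k * ‖iteratedFDeriv ℝ l (fun y => g y * ψ y) x‖ ≤
      2 ^ l * A * SchwartzMap.seminormUpTo k l ψ := by
  have hP := SchwartzMap.seminormUpTo_nonneg k l ψ
  by_cases hx : x ∈ tsupport ψ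
  · have h1 := norm_iteratedFDeriv_mul_le (n := l) (N := ∞) hg (ψ.smooth ⊤) x (mod_cast le_top)
    calc ‖x‖ ^ k * ‖iteratedFDeriv ℝ l (fun y => g y * ψ y) x‖
        ≤ ‖x‖ ^ k * ∑ i ∈ Finset.range (l + 1),
          (l.choose i : ℝ) * ‖iteratedFDeriv ℝ i g x‖ * ‖iteratedFDeriv ℝ (l - i) ψ x‖ := by
          gcongr
      _ = ∑ i ∈ Finset.range (l + 1), (l.choose i : ℝ) * ‖iteratedFDeriv ℝ i g x‖ *
          (‖x‖ ^ k * ‖iteratedFDeriv ℝ (l - i) ψ x‖) := by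
          rw [Finset.mul_sum]; exact Finset.sum_congr rfl fun i _ => by ring
      _ ≤ ∑ i ∈ Finset.range (l + 1), (l.choose i : ℝ) * A * SchwartzMap.seminormUpTo k l ψ := by
          refine Finset.sum_le_sum fun i hi => ?_
          have hi' : i ≤ l := Nat.lt_succ_iff.mp (Finset.mem_range.mp hi)
          gcongr
          · exact h hx i hi'
          · exact (SchwartzMap.le_seminorm ℂ k (l - i) ψ x).trans
              (SchwartzMap.seminorm_le_seminormUpTo k (Nat.sub_le _ _) ψ)
      _ = _ := by
          rw [← Finset.sum_mul, ← Finset.sum_mul]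
          congr 2
          exact_mod_cast Nat.sum_range_choose l
  · have h0 : iteratedFDeriv ℝ l (fun y => g y * ψ y) x = 0 := by
      by_contra hne
      exact hx (tsupport_mul_subset_right (support_iteratedFDeriv_subset (𝕜 := ℝ) l hne))
    rw [h0]
    simp only [norm_zero, mul_zero]
    positivity

/-- Multiplication by a smooth function is bounded, without loss of derivatives or of weight, on
the Schwartz functions supported in a fixed bounded set. -/
theorem SchwartzMap.exists_seminormUpTo_smulLeftCLM_le {g : E → ℂ} (hg : g.HasTemperateGrowth)
    {K : Set E} (hK : Bornology.IsBounded K) (k l : ℕ) :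
    ∃ C, 0 ≤ C ∧ ∀ ψ : 𝓢(E, ℂ), tsupport ψ ⊆ K →
      SchwartzMap.seminormUpTo k l (SchwartzMap.smulLeftCLM ℂ g ψ) ≤
        C * SchwartzMap.seminormUpTo k l ψ := by
  obtain ⟨R, hR⟩ := hK.exists_norm_le
  obtain ⟨p, A, hA, hgA⟩ := hg.norm_iteratedFDeriv_le_uniform l
  set D := A * (1 + |R|) ^ p with hD
  have hD0 : 0 ≤ D := by positivity
  refine ⟨∑ j ∈ Finset.range (l + 1), 2 ^ j * D, by positivity, fun ψ hψ => ?_⟩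
  rw [Finset.sum_mul]
  refine Finset.sum_le_sum fun j hj => ?_
  have hj' : j ≤ l := Nat.lt_succ_iff.mp (Finset.mem_range.mp hj)
  have hP := SchwartzMap.seminormUpTo_nonneg k l ψ
  refine SchwartzMap.seminorm_le_bound ℂ k j _ (by positivity) fun x => ?_
  have h1 : (⇑(SchwartzMap.smulLeftCLM ℂ g ψ) : E → ℂ) = fun y => g y * ψ y := by
    rw [SchwartzMap.smulLeftCLM_apply hg]; rfl
  rw [h1]
  refine (SchwartzMap.pow_mul_norm_iteratedFDeriv_mul_le hg.1 ψ k j D hD0 x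
    fun hx i hi => (hgA i (hi.trans hj') x).trans ?_).trans ?_
  · rw [hD]
    gcongr
    exact (hR x (hψ hx)).trans (le_abs_self R)
  · gcongr
    exact Finset.sum_le_sum_of_subset_of_nonneg (by gcongr) fun _ _ _ => apply_nonneg _ _

/-- Every Schwartz function is the limit of its products with dilated cut-offs. -/
theorem SchwartzMap.tendsto_smulLeftCLM_cutoff {κ : E → ℂ} (hκ : ContDiff ℝ ∞ κ)
    (hc : HasCompactSupport κ) (h1 : ∀ x, ‖x‖ < 1 → κ x = 1) (ψ : 𝓢(E, ℂ)) :
    Tendsto (fun N : ℕ => SchwartzMap.smulLeftCLM ℂ (fun x => κ (((N : ℝ) + 1)⁻¹ • x)) ψ)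
      atTop (𝓝 ψ) := by
  have hbd : ∀ j : ℕ, ∃ A, ∀ x, ‖iteratedFDeriv ℝ j κ x‖ ≤ A := fun j =>
    (hκ.continuous_iteratedFDeriv (mod_cast le_top)).bounded_above_of_compact_support
      (hc.iteratedFDeriv j)
  choose A hA using hbd
  have hA0 : ∀ j, 0 ≤ A j := fun j => (norm_nonneg _).trans (hA j 0)
  rw [(schwartz_withSeminorms ℂ E ℂ).tendsto_nhds]
  rintro ⟨k, l⟩ ε hε
  set B := ∑ j ∈ Finset.range (l + 1), A j with hB
  set D := (2 ^ l * B + 1) * SchwartzMap.seminormUpTo (k + 1) l ψ with hD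
  have hB0 : 0 ≤ B := Finset.sum_nonneg fun j _ => hA0 j
  have hD0 : 0 ≤ D := mul_nonneg (by positivity) (SchwartzMap.seminormUpTo_nonneg _ _ _)
  have hlim : Tendsto (fun N : ℕ => ((N : ℝ) + 1)⁻¹ * D) atTop (𝓝 (0 * D)) :=
    (tendsto_inv_atTop_zero.comp
      (tendsto_atTop_add_const_right _ _ tendsto_natCast_atTop_atTop)).mul_const D
  rw [zero_mul] at hlim
  filter_upwards [hlim.eventually_lt_const hε] with N hN
  refine lt_of_le_of_lt ?_ hN
  set c : ℝ := ((N : ℝ) + 1)⁻¹ with hcdef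
  have hc0 : 0 ≤ c := by positivity
  have hc1 : c ≤ 1 := inv_le_one_of_one_le₀ (by linarith [Nat.cast_nonneg (α := ℝ) N])
  have hg : ContDiff ℝ ∞ fun x => κ (c • x) := hκ.comp (contDiff_const_smul c)
  have hgA : ∀ j ≤ l, ∀ x, ‖iteratedFDeriv ℝ j (fun x => κ (c • x)) x‖ ≤ B := by
    intro j hj x
    rw [iteratedFDeriv_comp_const_smul c (hκ.of_le (mod_cast le_top)), norm_smul, norm_pow,
      Real.norm_of_nonneg hc0]
    calc c ^ j * ‖iteratedFDeriv ℝ j κ (c • x)‖ ≤ 1 * A j := by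
          gcongr
          · exact pow_le_one₀ hc0 hc1
          · exact hA j _
      _ ≤ B := by
          rw [one_mul]
          exact Finset.single_le_sum (f := A) (fun j _ => hA0 j)
            (by simpa [Nat.lt_succ_iff] using hj)
  have hgt : (fun x => κ (c • x)).HasTemperateGrowth := by
    refine ⟨hg, fun j => ⟨0, A j, fun x => ?_⟩⟩
    rw [iteratedFDeriv_comp_const_smul c (hκ.of_le (mod_cast le_top)), norm_smul, norm_pow,
      Real.norm_of_nonneg hc0, pow_zero, mul_one]
    calc c ^ j * ‖iteratedFDeriv ℝ j κ (c • x)‖ ≤ 1 * A j := by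
          gcongr
          · exact pow_le_one₀ hc0 hc1
          · exact hA j _
      _ = A j := one_mul _
  rw [SchwartzMap.schwartzSeminormFamily_apply]
  refine SchwartzMap.seminorm_le_bound ℂ k l _ (by positivity) fun x => ?_
  have hcoe : (⇑(SchwartzMap.smulLeftCLM ℂ (fun x => κ (c • x)) ψ - ψ) : E → ℂ) =
      (fun y => κ (c • y) * ψ y) - ψ := by
    funext y
    simp [hgt]
  rw [hcoe]
  rcases lt_or_ge ‖c • x‖ 1 with hx | hx
  · have hz : ((fun y => κ (c • y) * ψ y) - (ψ : E → ℂ)) =ᶠ[𝓝 x] fun _ => (0 : ℂ) := by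
      have hopen : ∀ᶠ y in 𝓝 x, ‖c • y‖ < 1 :=
        (by fun_prop : Continuous fun y : E => ‖c • y‖).continuousAt.eventually_lt_const hx
      filter_upwards [hopen] with y hy
      simp [h1 _ hy]
    rw [Filter.EventuallyEq.eq_of_nhds (hz.iteratedFDeriv ℝ l)]
    have : iteratedFDeriv ℝ l (fun _ : E => (0 : ℂ)) x = 0 := by
      simp
    rw [this]
    simp only [norm_zero, mul_zero]
    positivity
  · rw [norm_smul, Real.norm_of_nonneg hc0] at hx
    have hsub : iteratedFDeriv ℝ l ((fun y => κ (c • y) * ψ y) - (ψ : E → ℂ)) x =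
        iteratedFDeriv ℝ l (fun y => κ (c • y) * ψ y) x - iteratedFDeriv ℝ l ψ x :=
      iteratedFDeriv_sub_apply ((hg.mul (ψ.smooth ⊤)).of_le (mod_cast le_top)).contDiffAt
        ((ψ.smooth ⊤).of_le (mod_cast le_top)).contDiffAt
    rw [hsub]
    have e1 := SchwartzMap.pow_mul_norm_iteratedFDeriv_mul_le hg ψ (k + 1) l B hB0 x
      fun _ j hj => hgA j hj x
    have e2 := (SchwartzMap.le_seminorm ℂ (k + 1) l ψ x).trans
      (SchwartzMap.seminorm_le_seminormUpTo (k + 1) le_rfl ψ)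
    calc ‖x‖ ^ k * ‖iteratedFDeriv ℝ l (fun y => κ (c • y) * ψ y) x - iteratedFDeriv ℝ l ψ x‖
        ≤ (c * ‖x‖) * (‖x‖ ^ k * (‖iteratedFDeriv ℝ l (fun y => κ (c • y) * ψ y) x‖ +
          ‖iteratedFDeriv ℝ l ψ x‖)) := by
          refine le_trans ?_ (le_mul_of_one_le_left (by positivity) hx)
          gcongr
          exact norm_sub_le _ _
      _ = c * (‖x‖ ^ (k + 1) * ‖iteratedFDeriv ℝ l (fun y => κ (c • y) * ψ y) x‖ +
          ‖x‖ ^ (k + 1) * ‖iteratedFDeriv ℝ l ψ x‖) := by ring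
      _ ≤ c * (2 ^ l * B * SchwartzMap.seminormUpTo (k + 1) l ψ +
          SchwartzMap.seminormUpTo (k + 1) l ψ) := by gcongr
      _ = c * D := by rw [hD]; ring

end SchwartzSeries

section MatrixExponential

variable {ι : Type*} [Fintype ι] [DecidableEq ι]

open scoped Matrix.Norms.Operator in
/-- The power series of an entry of the exponential of a matrix. -/
theorem Matrix.hasSum_exp_apply (A : Matrix ι ι ℂ) (i j : ι) :
    HasSum (fun m : ℕ => ((m.factorial : ℂ))⁻¹ * (A ^ m) i j) (NormedSpace.exp A i j) := by
  have h := NormedSpace.exp_series_hasSum_exp' (𝕂 := ℂ) A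
  have h1 : HasSum (fun m : ℕ => (((m.factorial : ℂ))⁻¹ • A ^ m) i j) (NormedSpace.exp A i j) :=
    Pi.hasSum.mp (Pi.hasSum.mp h i) j
  simpa using h1

open scoped Matrix.Norms.Operator in
theorem Matrix.hasDerivAt_exp_real_smul_apply (A : Matrix ι ι ℂ) (t : ℝ) (i j : ι) :
    HasDerivAt (fun r : ℝ => NormedSpace.exp (r • A) i j)
      (∑ k, A i k * NormedSpace.exp (t • A) k j) t := by
  have h := hasDerivAt_exp_smul_const' (𝕂 := ℝ) A t
  have h1 : HasDerivAt (fun r : ℝ => NormedSpace.exp (r • A) i j)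
      ((A * NormedSpace.exp (t • A)) i j) t := hasDerivAt_pi.mp (hasDerivAt_pi.mp h i) j
  rwa [Matrix.mul_apply] at h1

open scoped Matrix.Norms.Operator in
theorem Matrix.continuous_exp_smul_apply {α : Type*} [TopologicalSpace α] {A : α → Matrix ι ι ℂ}
    (hA : ∀ i j, Continuous fun x => A x i j) (t : ℝ) (i j : ι) :
    Continuous fun x => NormedSpace.exp (t • A x) i j := by
  have h : Continuous fun x => t • A x :=
    (continuous_pi fun i => continuous_pi fun j => hA i j).const_smul t
  exact (continuous_apply j).comp ((continuous_apply i).comp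
    (NormedSpace.exp_continuous.comp h))

theorem Matrix.norm_pow_apply_le {A : Matrix ι ι ℂ} {r : ℝ} (hA : ∀ i j, ‖A i j‖ ≤ r) (m : ℕ)
    (i j : ι) : ‖(A ^ m) i j‖ ≤ (Fintype.card ι * r) ^ m := by
  have hr : 0 ≤ r := (norm_nonneg _).trans (hA i i)
  induction m generalizing j with
  | zero => 
    rw [pow_zero, pow_zero, Matrix.one_apply]
    split_ifs <;> simp
  | succ m ih =>
    rw [pow_succ, Matrix.mul_apply, pow_succ]
    refine (norm_sum_le _ _).trans ?_
    calc ∑ k, ‖(A ^ m) i k * A k j‖ ≤ ∑ _k : ι, (Fintype.card ι * r) ^ m * r := by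
          refine Finset.sum_le_sum fun k _ => ?_
          rw [norm_mul]
          gcongr
          · exact ih k
          · exact hA k j
      _ = _ := by simp; ring

end MatrixExponential

section Taylor

theorem summable_pow_div_sqrt_factorial (K : ℝ) :
    Summable fun m : ℕ => K ^ m / √(m.factorial : ℝ) := by
  rcases eq_or_ne K 0 with rfl | hK
  · refine summable_of_ne_finset_zero (s := {0}) fun m hm => ?_
    rw [zero_pow (by simpa using hm), zero_div]
  refine summable_of_ratio_test_tendsto_lt_one (l := 0) one_pos (Eventually.of_forall fun m => ?_)
    ?_
  · have : 0 < √(m.factorial : ℝ) := Real.sqrt_pos.mpr (by positivity)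
    positivity
  · have h : ∀ m : ℕ, ‖K ^ (m + 1) / √((m + 1).factorial : ℝ)‖ / ‖K ^ m / √(m.factorial : ℝ)‖ =
        |K| * (√((m : ℝ) + 1))⁻¹ := by
      intro m
      have h1 : 0 < √(m.factorial : ℝ) := Real.sqrt_pos.mpr (by positivity)
      have h2 : 0 < √((m : ℝ) + 1) := Real.sqrt_pos.mpr (by positivity)
      have h3 : |K| ≠ 0 := abs_ne_zero.mpr hK
      rw [Nat.factorial_succ, Nat.cast_mul, Real.sqrt_mul (by positivity)]
      simp only [norm_div, norm_pow, Real.norm_eq_abs, norm_mul, abs_of_pos h1]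
      push_cast
      rw [abs_of_pos h2]
      field_simp
      ring
    simp_rw [h]
    have : Tendsto (fun m : ℕ => (√((m : ℝ) + 1))⁻¹) atTop (𝓝 0) :=
      tendsto_inv_atTop_zero.comp (Real.tendsto_sqrt_atTop.comp
        (tendsto_atTop_add_const_right _ _ tendsto_natCast_atTop_atTop))
    simpa using this.const_mul |K|

theorem hasDerivWithinAt_Ici_of_continuousOn {f g : ℝ → ℂ} (hf : ContinuousOn f (Set.Ici 0))
    (hg : ContinuousOn g (Set.Ici 0)) (h : ∀ t, 0 < t → HasDerivAt f (g t) t) {t : ℝ}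
    (ht : 0 ≤ t) : HasDerivWithinAt f (g t) (Set.Ici t) t := by
  rcases ht.eq_or_lt with rfl | ht
  · refine hasDerivWithinAt_Ici_of_tendsto_deriv (s := Set.Ioi 0)
      (fun x hx => (h x hx).differentiableAt.differentiableWithinAt)
      ((hf 0 Set.self_mem_Ici).mono Set.Ioi_subset_Ici_self) self_mem_nhdsWithin ?_
    refine ((hg 0 Set.self_mem_Ici).mono Set.Ioi_subset_Ici_self).tendsto.congr' ?_
    filter_upwards [self_mem_nhdsWithin] with x hx
    exact (h x hx).deriv.symm
  · exact (h t ht).hasDerivWithinAt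

/-- Taylor's formula for a sequence of functions each of which is the derivative of the preceding
one. -/
theorem norm_sub_taylor_le {f : ℕ → ℝ → ℂ} (hc : ∀ m, ContinuousOn (f m) (Set.Ici 0))
    (hd : ∀ m t, 0 < t → HasDerivAt (f m) (f (m + 1) t) t) {T : ℝ} {a : ℕ → ℝ}
    (ha : ∀ m, ∀ s ∈ Set.Icc 0 T, ‖f m s‖ ≤ a m) (M k : ℕ) :
    ∀ t ∈ Set.Icc 0 T, ‖f k t - ∑ m ∈ Finset.range M,
      ((t ^ m / (m.factorial : ℝ) : ℝ) : ℂ) * f (k + m) 0‖ ≤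
        a (k + M) * (t ^ M / (M.factorial : ℝ)) := by
  induction M generalizing k with
  | zero => intro t ht; simpa using ha k t ht
  | succ M ih =>
    have hdp : ∀ (m : ℕ) (t : ℝ), HasDerivAt (fun t : ℝ => t ^ (m + 1) / ((m + 1).factorial : ℝ))
        (t ^ m / (m.factorial : ℝ)) t := by
      intro m t
      refine ((hasDerivAt_pow (m + 1) t).div_const ((m + 1).factorial : ℝ)).congr_deriv ?_
      rw [Nat.factorial_succ]
      push_cast
      field_simp
    have hS : ∀ t : ℝ, HasDerivAt (fun t : ℝ => ∑ m ∈ Finset.range (M + 1),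
        ((t ^ m / (m.factorial : ℝ) : ℝ) : ℂ) * f (k + m) 0)
        (∑ m ∈ Finset.range M, ((t ^ m / (m.factorial : ℝ) : ℝ) : ℂ) * f (k + 1 + m) 0) t := by
      intro t
      simp_rw [Finset.sum_range_succ']
      have h0 : HasDerivAt (fun t : ℝ => ∑ m ∈ Finset.range M,
          ((t ^ (m + 1) / ((m + 1).factorial : ℝ) : ℝ) : ℂ) * f (k + (m + 1)) 0)
          (∑ m ∈ Finset.range M, ((t ^ m / (m.factorial : ℝ) : ℝ) : ℂ) * f (k + 1 + m) 0) t := by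
        refine HasDerivAt.fun_sum fun m _ => ?_
        have := ((hdp m t).ofReal_comp).mul_const (f (k + (m + 1)) 0)
        rwa [show k + 1 + m = k + (m + 1) by ring]
      simpa using h0.add_const (f k 0)
    have key := image_norm_le_of_norm_deriv_right_le_deriv_boundary (a := 0) (b := T)
      (f := fun t => f k t - ∑ m ∈ Finset.range (M + 1),
        ((t ^ m / (m.factorial : ℝ) : ℝ) : ℂ) * f (k + m) 0)
      (f' := fun t => f (k + 1) t - ∑ m ∈ Finset.range M,
        ((t ^ m / (m.factorial : ℝ) : ℝ) : ℂ) * f (k + 1 + m) 0)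
      (B := fun t => a (k + 1 + M) * (t ^ (M + 1) / ((M + 1).factorial : ℝ)))
      (B' := fun t => a (k + 1 + M) * (t ^ M / (M.factorial : ℝ)))
      (((hc k).mono Set.Icc_subset_Ici_self).sub
        (fun t _ => (hS t).continuousAt.continuousWithinAt))
      (fun t ht => (hasDerivWithinAt_Ici_of_continuousOn (hc k) (hc (k + 1)) (hd k) ht.1).sub
        (hS t).hasDerivWithinAt)
      (by simp [Finset.sum_range_succ'])
      (fun t => (hdp M t).const_mul _)
      (fun t ht => ih (k + 1) t (Set.Ico_subset_Icc_self ht))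
    intro t ht
    have := key ht
    rwa [show k + 1 + M = k + (M + 1) by ring] at this

/-- A function whose successive derivatives grow at most like the square root of the factorial is
the sum of its Taylor series. -/
theorem tendsto_taylor_of_norm_le_sqrt_factorial {f : ℕ → ℝ → ℂ}
    (hc : ∀ m, ContinuousOn (f m) (Set.Ici 0))
    (hd : ∀ m t, 0 < t → HasDerivAt (f m) (f (m + 1) t) t) {t C : ℝ} (ht : 0 ≤ t)
    (hC : ∀ m, ∀ s ∈ Set.Icc 0 t, ‖f m s‖ ≤ C * √(m.factorial : ℝ)) :
    Tendsto (fun M => ∑ m ∈ Finset.range M, ((t ^ m / (m.factorial : ℝ) : ℝ) : ℂ) * f m 0) atTop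
      (𝓝 (f 0 t)) := by
  rw [tendsto_iff_norm_sub_tendsto_zero]
  have h0 : Tendsto (fun M : ℕ => C * (t ^ M / √(M.factorial : ℝ))) atTop (𝓝 (C * 0)) :=
    (summable_pow_div_sqrt_factorial t).tendsto_atTop_zero.const_mul C
  rw [mul_zero] at h0
  refine squeeze_zero (fun _ => norm_nonneg _) (fun M => ?_) h0
  have := norm_sub_taylor_le hc hd hC M 0 t ⟨ht, le_rfl⟩
  simp only [zero_add] at this
  rw [norm_sub_rev]
  refine this.trans (le_of_eq ?_)
  have h1 : 0 < √(M.factorial : ℝ) := Real.sqrt_pos.mpr (by positivity)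
  have h2 : (M.factorial : ℝ) = √(M.factorial : ℝ) * √(M.factorial : ℝ) :=
    (Real.mul_self_sqrt (by positivity)).symm
  rw [mul_assoc]
  congr 1
  nth_rewrite 2 [h2]
  field_simp

end Taylor

section Flow

variable {n : ℕ} {ι : Type*} [Fintype ι] [DecidableEq ι]

theorem Matrix.hasTemperateGrowth_pow {B : Rn n → Matrix ι ι ℂ}
    (hB : ∀ i j, (fun ξ => B ξ i j).HasTemperateGrowth) (m : ℕ) (i j : ι) :
    (fun ξ => (B ξ ^ m) i j).HasTemperateGrowth := by
  induction m generalizing j with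
  | zero =>
    simp only [pow_zero]
    exact Function.HasTemperateGrowth.const _
  | succ m ih =>
    simp only [pow_succ, Matrix.mul_apply]
    exact Function.HasTemperateGrowth.sum fun k _ => (ih k).mul (hB k j)

theorem SchwartzMap.smulLeftCLM_matrix_pow_succ {B : Rn n → Matrix ι ι ℂ}
    (hB : ∀ i j, (fun ξ => B ξ i j).HasTemperateGrowth) {κ : Rn n → ℂ}
    (hκ : κ.HasTemperateGrowth) (ψ : 𝓢(Rn n, ℂ)) (i : ι) (m : ℕ) (j : ι) :
    SchwartzMap.smulLeftCLM ℂ (fun ξ => (B ξ ^ (m + 1)) i j * κ ξ) ψ =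
      ∑ k, SchwartzMap.smulLeftCLM ℂ (fun ξ => B ξ k j)
        (SchwartzMap.smulLeftCLM ℂ (fun ξ => (B ξ ^ m) i k * κ ξ) ψ) := by
  have hg : ∀ m j, (fun ξ => (B ξ ^ m) i j * κ ξ).HasTemperateGrowth := fun m j =>
    (Matrix.hasTemperateGrowth_pow hB m i j).mul hκ
  ext ξ
  have h1 : ∀ k, SchwartzMap.smulLeftCLM ℂ (fun ξ => B ξ k j)
      (SchwartzMap.smulLeftCLM ℂ (fun ξ => (B ξ ^ m) i k * κ ξ) ψ) ξ =
        (B ξ ^ m) i k * B ξ k j * (κ ξ * ψ ξ) := fun k => by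
    rw [SchwartzMap.smulLeftCLM_apply_apply (hB k j),
      SchwartzMap.smulLeftCLM_apply_apply (hg m k), smul_eq_mul, smul_eq_mul]
    ring
  rw [sum_apply, SchwartzMap.smulLeftCLM_apply_apply (hg (m + 1) j), Finset.sum_congr rfl
    fun k _ => h1 k, ← Finset.sum_mul, ← Matrix.mul_apply, ← pow_succ, smul_eq_mul, mul_assoc]

/-- The products of a localized Schwartz function with the entries of the powers of a matrix of
functions grow at most geometrically, in each Schwartz seminorm. -/
theorem exists_seminorm_matrix_pow_le {B : Rn n → Matrix ι ι ℂ}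
    (hB : ∀ i j, (fun ξ => B ξ i j).HasTemperateGrowth) {κ : Rn n → ℂ}
    (hκ : κ.HasTemperateGrowth) {Z : Set (Rn n)} (hZ : IsCompact Z)
    (hκZ : Function.support κ ⊆ Z) (ψ : 𝓢(Rn n, ℂ)) (i : ι) (k l : ℕ) :
    ∃ C K : ℝ, 0 ≤ C ∧ ∀ m j, SchwartzMap.seminorm ℂ k l
      (SchwartzMap.smulLeftCLM ℂ (fun ξ => (B ξ ^ m) i j * κ ξ) ψ) ≤ C * K ^ m := by
  choose c hc0 hc using fun j k' => SchwartzMap.exists_seminormUpTo_smulLeftCLM_le (hB j k')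
    hZ.isBounded k l
  have hηg : ∀ m j, (fun ξ => (B ξ ^ m) i j * κ ξ).HasTemperateGrowth := fun m j =>
    (Matrix.hasTemperateGrowth_pow hB m i j).mul hκ
  set η : ℕ → ι → 𝓢(Rn n, ℂ) := fun m j =>
    SchwartzMap.smulLeftCLM ℂ (fun ξ => (B ξ ^ m) i j * κ ξ) ψ with hη
  have hηs : ∀ m j, tsupport (η m j) ⊆ Z := fun m j => by
    refine closure_minimal (fun ξ hξ => hκZ fun h0 => hξ ?_) hZ.isClosed
    simp [hη, hηg m j, h0]
  have hrec : ∀ m j, η (m + 1) j =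
      ∑ k' : ι, SchwartzMap.smulLeftCLM ℂ (fun ξ => B ξ k' j) (η m k') := fun m j =>
    SchwartzMap.smulLeftCLM_matrix_pow_succ hB hκ ψ i m j
  set C := ∑ j, SchwartzMap.seminormUpTo k l (η 0 j) with hC
  set K := ∑ j, ∑ k', c k' j with hK
  have hC0 : 0 ≤ C := Finset.sum_nonneg fun j _ => SchwartzMap.seminormUpTo_nonneg _ _ _
  have hK0 : 0 ≤ K := Finset.sum_nonneg fun j _ => Finset.sum_nonneg fun k' _ => hc0 _ _
  have main : ∀ m j, SchwartzMap.seminormUpTo k l (η m j) ≤ C * K ^ m := by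
    intro m
    induction m with
    | zero =>
      intro j
      rw [pow_zero, mul_one]
      exact Finset.single_le_sum (f := fun j => SchwartzMap.seminormUpTo k l (η 0 j))
        (fun j _ => SchwartzMap.seminormUpTo_nonneg _ _ _) (Finset.mem_univ j)
    | succ m ih =>
      intro j
      rw [hrec]
      calc _ ≤ ∑ k', SchwartzMap.seminormUpTo k l
            (SchwartzMap.smulLeftCLM ℂ (fun ξ => B ξ k' j) (η m k')) :=
            SchwartzMap.seminormUpTo_sum_le _ _ _ _
        _ ≤ ∑ k', c k' j * (C * K ^ m) := Finset.sum_le_sum fun k' _ =>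
            (hc k' j _ (hηs m k')).trans (mul_le_mul_of_nonneg_left (ih k') (hc0 _ _))
        _ = (∑ k', c k' j) * (C * K ^ m) := (Finset.sum_mul _ _ _).symm
        _ ≤ K * (C * K ^ m) := by
            gcongr
            exact Finset.single_le_sum (f := fun j => ∑ k', c k' j)
              (fun j _ => Finset.sum_nonneg fun k' _ => hc0 _ _) (Finset.mem_univ j)
        _ = C * K ^ (m + 1) := by ring
  exact ⟨C, K, hC0, fun m j =>
    (SchwartzMap.seminorm_le_seminormUpTo k le_rfl _).trans (main m j)⟩

/-- Let the tempered distributions `X i t` solve the linear system `X' = B X` with a matrix `B` of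
smooth functions.  If the products of the initial values with a cut-off `κ` are integrable
functions `h j`, then the products of the `X i t` with `κ` are the functions given by the
exponential of `t B`. -/
theorem flow_eq_integral_exp {B : Rn n → Matrix ι ι ℂ}
    (hB : ∀ i j, (fun ξ => B ξ i j).HasTemperateGrowth) {X : ι → ℝ → TDist n}
    (hc : ∀ i (ψ : 𝓢(Rn n, ℂ)), ContinuousOn (fun t => X i t ψ) (Set.Ici 0))
    (hd : ∀ i (ψ : 𝓢(Rn n, ℂ)) (t : ℝ), 0 < t → HasDerivAt (fun r => X i r ψ)
      (∑ j, X j t (SchwartzMap.smulLeftCLM ℂ (fun ξ => B ξ i j) ψ)) t)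
    {κ : Rn n → ℂ} (hκ : κ.HasTemperateGrowth) {Z : Set (Rn n)} (hZ : IsCompact Z)
    (hκZ : Function.support κ ⊆ Z) {h : ι → Rn n → ℂ} (hh : ∀ j, Integrable (h j))
    (hhZ : ∀ j, ∀ᵐ ξ, ξ ∉ Z → h j ξ = 0)
    (hX : ∀ j (ψ : 𝓢(Rn n, ℂ)), X j 0 (SchwartzMap.smulLeftCLM ℂ κ ψ) = ∫ ξ, ψ ξ * h j ξ)
    {t : ℝ} (ht : 0 ≤ t) (i : ι) (ψ : 𝓢(Rn n, ℂ)) :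
    X i t (SchwartzMap.smulLeftCLM ℂ κ ψ) =
      ∫ ξ, ψ ξ * ∑ j, NormedSpace.exp (t • B ξ) i j * h j ξ := by
  have hpg := Matrix.hasTemperateGrowth_pow hB
  have hηg : ∀ m j, (fun ξ => (B ξ ^ m) i j * κ ξ).HasTemperateGrowth := fun m j =>
    (hpg m i j).mul hκ
  set η : ℕ → ι → 𝓢(Rn n, ℂ) := fun m j =>
    SchwartzMap.smulLeftCLM ℂ (fun ξ => (B ξ ^ m) i j * κ ξ) ψ with hη
  have hrec : ∀ m j, η (m + 1) j =
      ∑ k : ι, SchwartzMap.smulLeftCLM ℂ (fun ξ => B ξ k j) (η m k) := fun m j =>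
    SchwartzMap.smulLeftCLM_matrix_pow_succ hB hκ ψ i m j
  set f : ℕ → ℝ → ℂ := fun m r => ∑ j, X j r (η m j) with hf
  have hfc : ∀ m, ContinuousOn (f m) (Set.Ici 0) := fun m =>
    continuousOn_finsetSum _ fun j _ => hc j _
  have hfd : ∀ m r, 0 < r → HasDerivAt (f m) (f (m + 1) r) r := by
    intro m r hr
    have h1 : HasDerivAt (f m) (∑ j, ∑ k, X k r (SchwartzMap.smulLeftCLM ℂ (fun ξ => B ξ j k)
        (η m j))) r := HasDerivAt.fun_sum fun j _ => hd j _ r hr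
    refine h1.congr_deriv ?_
    rw [Finset.sum_comm]
    refine Finset.sum_congr rfl fun k _ => ?_
    rw [hrec]
    exact (map_sum (X k r) _ _).symm
  have hbound : ∃ C, ∀ m, ∀ s ∈ Set.Icc 0 t, ‖f m s‖ ≤ C * √(m.factorial : ℝ) := by
    have hj : ∀ j, ∃ C, ∀ (s : Set.Icc (0 : ℝ) t) (m : ℕ),
        ‖X j s (((√(m.factorial : ℝ))⁻¹ : ℂ) • η m j)‖ ≤ C := by
      intro j
      refine TemperedDistribution.exists_uniform_bound (fun s : Set.Icc (0 : ℝ) t => X j s)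
        (fun φ => ?_) _ fun k l => ?_
      · obtain ⟨C, hC⟩ := isCompact_Icc.exists_bound_of_continuousOn
          ((hc j φ).mono (Set.Icc_subset_Ici_self : Set.Icc 0 t ⊆ _))
        exact ⟨C, fun s => hC s s.2⟩
      · obtain ⟨C, K, hC0, hCK⟩ := exists_seminorm_matrix_pow_le hB hκ hZ hκZ ψ i k l
        refine Summable.of_nonneg_of_le (fun _ => apply_nonneg _ _) (fun m => ?_)
          ((summable_pow_div_sqrt_factorial K).mul_left C)
        rw [map_smul_eq_mul, norm_inv, Complex.norm_real,
          Real.norm_of_nonneg (Real.sqrt_nonneg _)]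
        calc _ ≤ (√(m.factorial : ℝ))⁻¹ * (C * K ^ m) := by gcongr; exact hCK m j
          _ = _ := by ring
    choose C hC using hj
    refine ⟨∑ j, C j, fun m s hs => ?_⟩
    rw [Finset.sum_mul]
    refine (norm_sum_le _ _).trans (Finset.sum_le_sum fun j _ => ?_)
    have h1 := hC j ⟨s, hs⟩ m
    have h2 : 0 < √(m.factorial : ℝ) := Real.sqrt_pos.mpr (by positivity)
    rw [map_smul, norm_smul, norm_inv, Complex.norm_real, Real.norm_of_nonneg h2.le,
      inv_mul_le_iff₀ h2] at h1
    linarith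
  obtain ⟨C, hC⟩ := hbound
  have hlim := tendsto_taylor_of_norm_le_sqrt_factorial hfc hfd ht hC
  have hf0 : f 0 t = X i t (SchwartzMap.smulLeftCLM ℂ κ ψ) := by
    simp only [hf, hη]
    rw [Finset.sum_eq_single i]
    · simp
    · intro j _ hji
      have : (fun ξ => (B ξ ^ 0) i j * κ ξ) = fun _ => (0 : ℂ) := by
        funext ξ
        simp [Matrix.one_apply_ne' hji]
      rw [this, SchwartzMap.smulLeftCLM_const]
      simp
    · simp
  -- the terms of the Taylor series
  set g : ℕ → Rn n → ℂ := fun m ξ => ∑ j, ((t ^ m / (m.factorial : ℝ) : ℝ) : ℂ) *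
    ((B ξ ^ m) i j * ψ ξ * h j ξ) with hg
  obtain ⟨r, hr0, hr⟩ : ∃ r, 0 ≤ r ∧ ∀ ξ ∈ Z, ∀ j k, ‖B ξ j k‖ ≤ r := by
    have := fun j k => hZ.exists_bound_of_continuousOn (hB j k).1.continuous.continuousOn
    choose r hr using this
    refine ⟨∑ j, ∑ k, |r j k|, by positivity, fun ξ hξ j k => ?_⟩
    refine (hr j k ξ hξ).trans ((le_abs_self _).trans ?_)
    refine (Finset.single_le_sum (f := fun k => |r j k|) (fun _ _ => abs_nonneg _)
      (Finset.mem_univ k)).trans ?_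
    exact Finset.single_le_sum (f := fun j => ∑ k, |r j k|)
      (fun _ _ => Finset.sum_nonneg fun _ _ => abs_nonneg _) (Finset.mem_univ j)
  obtain ⟨P, hP⟩ : ∃ P, ∀ ξ, ‖ψ ξ‖ ≤ P :=
    ⟨_, fun ξ => SchwartzMap.norm_le_seminorm ℂ ψ ξ⟩
  have hP0 : 0 ≤ P := (norm_nonneg _).trans (hP 0)
  set R := Fintype.card ι * r with hR
  have hR0 : 0 ≤ R := by positivity
  have hm : ∀ m j, Integrable fun ξ => (B ξ ^ m) i j * ψ ξ * h j ξ := by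
    intro m j
    refine Integrable.mono' ((hh j).norm.const_mul (R ^ m * P))
      (((hpg m i j).1.continuous.mul ψ.continuous).aestronglyMeasurable.mul
        (hh j).aestronglyMeasurable) ?_
    filter_upwards [hhZ j] with ξ hξ
    by_cases hz : ξ ∈ Z
    · rw [norm_mul, norm_mul]
      gcongr
      · exact Matrix.norm_pow_apply_le (hr ξ hz) m i j
      · exact hP ξ
    · rw [hξ hz]; simp
  have hgi : ∀ m, Integrable (g m) := fun m => integrable_finsetSum _ fun j _ =>
    (hm m j).const_mul _
  have hterm : ∀ m, ((t ^ m / (m.factorial : ℝ) : ℝ) : ℂ) * f m 0 = ∫ ξ, g m ξ := by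
    intro m
    rw [integral_finsetSum _ fun j _ => (hm m j).const_mul _, Finset.mul_sum]
    refine Finset.sum_congr rfl fun j _ => ?_
    rw [integral_const_mul]
    congr 1
    have : η m j = SchwartzMap.smulLeftCLM ℂ κ
        (SchwartzMap.smulLeftCLM ℂ (fun ξ => (B ξ ^ m) i j) ψ) := by
      rw [SchwartzMap.smulLeftCLM_smulLeftCLM_apply hκ (hpg m i j)]
      exact congrArg (fun g => SchwartzMap.smulLeftCLM ℂ g ψ) (funext fun ξ => mul_comm _ _)
    rw [this, hX]
    simp [hpg m i j]
  have hsum : Summable fun m => ∫ ξ, ‖g m ξ‖ := by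
    refine Summable.of_nonneg_of_le (fun m => integral_nonneg fun _ => norm_nonneg _) (fun m => ?_)
      ((Real.summable_pow_div_factorial (t * R)).mul_right (P * ∑ j, ∫ ξ, ‖h j ξ‖))
    rw [← integral_finsetSum _ fun j _ => (hh j).norm, ← integral_const_mul,
      ← integral_const_mul]
    refine integral_mono_ae (hgi m).norm
      (((integrable_finsetSum _ fun j _ => (hh j).norm).const_mul _).const_mul _) ?_
    filter_upwards [ae_all_iff.mpr hhZ] with ξ hξ
    by_cases hz : ξ ∈ Z
    · refine (norm_sum_le _ _).trans ?_
      simp only [Finset.mul_sum]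
      refine Finset.sum_le_sum fun j _ => ?_
      rw [norm_mul, norm_mul, norm_mul, Complex.norm_real, Real.norm_of_nonneg (by positivity)]
      calc t ^ m / (m.factorial : ℝ) * (‖(B ξ ^ m) i j‖ * ‖ψ ξ‖ * ‖h j ξ‖)
          ≤ t ^ m / (m.factorial : ℝ) * (R ^ m * P * ‖h j ξ‖) := by
            gcongr
            · exact Matrix.norm_pow_apply_le (hr ξ hz) m i j
            · exact hP ξ
        _ = (t * R) ^ m / (m.factorial : ℝ) * (P * ‖h j ξ‖) := by rw [mul_pow]; ring
    · simp only [hg, hξ _ hz]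
      simp
  have hfin := (hasSum_integral_of_summable_integral_norm hgi hsum).tendsto_sum_nat
  have hpt : ∀ ξ, ∑' m, g m ξ = ψ ξ * ∑ j, NormedSpace.exp (t • B ξ) i j * h j ξ := by
    intro ξ
    rw [Finset.mul_sum]
    refine HasSum.tsum_eq (hasSum_sum fun j _ => ?_)
    have h1 := ((Matrix.hasSum_exp_apply (t • B ξ) i j).mul_right (ψ ξ * h j ξ))
    rw [show ψ ξ * (NormedSpace.exp (t • B ξ) i j * h j ξ) =
      NormedSpace.exp (t • B ξ) i j * (ψ ξ * h j ξ) by ring]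
    refine h1.congr_fun fun m => ?_
    rw [smul_pow, Matrix.smul_apply, Complex.real_smul]
    push_cast
    ring
  rw [← hf0]
  refine tendsto_nhds_unique hlim ?_
  simp_rw [hpt] at hfin
  exact hfin.congr fun M => Finset.sum_congr rfl fun m _ => (hterm m).symm

end Flow

section Symbol

variable {n : ℕ}

/-- The Fourier symbol of the first-order system satisfied by the vector
`(u_t + τ u_tt, ∇(u + τ u_t), ∇ u_t)`, at the angular frequency `θ`.  The term
`-(|θ|² - θ θᵀ)`, which vanishes on gradients, makes the system dissipative in all directions. -/
def mgtSymbol (τ β : ℝ) (θ : Rn n) : Matrix (VIdx n) (VIdx n) ℂ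
  | Sum.inl _, Sum.inl _ => 0
  | Sum.inl _, Sum.inr (Sum.inl k) => Complex.I * (θ k : ℂ)
  | Sum.inl _, Sum.inr (Sum.inr k) => ((β - τ : ℝ) : ℂ) * (Complex.I * (θ k : ℂ))
  | Sum.inr (Sum.inl j), Sum.inl _ => Complex.I * (θ j : ℂ)
  | Sum.inr (Sum.inl j), Sum.inr (Sum.inl k) =>
      (θ j : ℂ) * (θ k : ℂ) - if j = k then ((‖θ‖ ^ 2 : ℝ) : ℂ) else 0
  | Sum.inr (Sum.inl _), Sum.inr (Sum.inr _) => 0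
  | Sum.inr (Sum.inr j), Sum.inl _ => ((τ⁻¹ : ℝ) : ℂ) * (Complex.I * (θ j : ℂ))
  | Sum.inr (Sum.inr _), Sum.inr (Sum.inl _) => 0
  | Sum.inr (Sum.inr j), Sum.inr (Sum.inr k) => if j = k then -((τ⁻¹ : ℝ) : ℂ) else 0

theorem abs_lyapunov_cross_le {τ γ K R N₁ N₂ N₃ p₂ p₃ c₁₂ c₁₃ : ℝ} (hτ : 0 < τ)
    (hK1 : 2 + 2 * τ ≤ K) (hK2 : 2 ≤ K * γ) (hR : 0 ≤ R) (h1 : 0 ≤ N₁) (h2 : 0 ≤ N₂) (h3 : 0 ≤ N₃)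
    (hp2 : p₂ ≤ R * N₂) (hp3 : p₃ ≤ R * N₃) (hc12 : c₁₂ ^ 2 ≤ N₁ * p₂) (hc13 : c₁₃ ^ 2 ≤ N₁ * p₃) :
    |(c₁₂ - 2 * τ * c₁₃) / (1 + R)| ≤ K / 2 * (N₁ + N₂ + τ * γ * N₃) := by
  have hR1 : 0 < 1 + R := by linarith
  have hR4 : 4 * R ≤ (1 + R) ^ 2 := by nlinarith [sq_nonneg (1 - R)]
  have aux : ∀ c N p : ℝ, 0 ≤ N → p ≤ R * N → c ^ 2 ≤ N₁ * p →
      |c| ≤ (1 + R) * ((N₁ + N) / 4) := by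
    intro c N p hN hp hc
    refine abs_le_of_sq_le_sq ?_ (by positivity)
    calc c ^ 2 ≤ N₁ * (R * N) := hc.trans (by gcongr)
      _ = 4 * R * (N₁ * N) / 4 := by ring
      _ ≤ (1 + R) ^ 2 * (N₁ * N) / 4 := by gcongr
      _ ≤ ((1 + R) * ((N₁ + N) / 4)) ^ 2 := by
          linarith [mul_nonneg (sq_nonneg (1 + R)) (sq_nonneg (N₁ - N))]
  rw [abs_div, abs_of_pos hR1, div_le_iff₀ hR1]
  have h4 : (N₁ + N₂) / 4 + 2 * τ * ((N₁ + N₃) / 4) ≤ K / 2 * (N₁ + N₂ + τ * γ * N₃) := by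
    have e1 : (2 + 2 * τ) * (N₁ + N₂) ≤ K * (N₁ + N₂) := by gcongr
    have e2 : 2 * (τ * N₃) ≤ K * γ * (τ * N₃) := by gcongr
    have e3 : 0 ≤ τ * N₂ := by positivity
    have e4 : 0 ≤ τ * N₁ := by positivity
    have e5 : 0 ≤ τ * N₃ := by positivity
    linarith
  calc |c₁₂ - 2 * τ * c₁₃| ≤ |c₁₂| + 2 * τ * |c₁₃| := by
        refine (abs_sub _ _).trans (le_of_eq ?_)
        rw [abs_mul, abs_of_pos (by positivity : 0 < 2 * τ)]
    _ ≤ (1 + R) * ((N₁ + N₂) / 4) + 2 * τ * ((1 + R) * ((N₁ + N₃) / 4)) := by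
        gcongr
        · exact aux _ _ _ h2 hp2 hc12
        · exact aux _ _ _ h3 hp3 hc13
    _ = ((N₁ + N₂) / 4 + 2 * τ * ((N₁ + N₃) / 4)) * (1 + R) := by ring
    _ ≤ K / 2 * (N₁ + N₂ + τ * γ * N₃) * (1 + R) := by gcongr

theorem lyapunov_dissipation_le {τ γ K M d R N₁ N₂ N₃ p₂ p₃ c₁₃ c₂₃ : ℝ} (hτ : 0 < τ)
    (hγ : 0 < γ) (hK1 : 1 ≤ K) (hK3 : M ^ 2 / 2 + 2 * τ * γ + 2 ≤ K * γ) (hd1 : d ≤ 1 / 2)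
    (hd2 : d * τ ≤ K) (hR : 0 ≤ R) (h1 : 0 ≤ N₁) (h2 : 0 ≤ N₂) (h3 : 0 ≤ N₃) (hp2 : 0 ≤ p₂)
    (hp3 : 0 ≤ p₃) (hp2N : p₂ ≤ R * N₂) (hp3N : p₃ ≤ R * N₃) (hc13 : c₁₃ ^ 2 ≤ N₁ * p₃)
    (hc23 : c₂₃ ^ 2 ≤ p₂ * p₃) :
    K * (-2 * (R * N₂ - p₂) - 2 * γ * N₃) +
      (-p₂ - R * N₁ + M * c₂₃ + 2 * τ * γ * p₃ + 2 * c₁₃) / (1 + R) ≤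
        -(d * (R / (1 + R)) * (N₁ + N₂ + τ * γ * N₃)) := by
  have hR1 : 0 < 1 + R := by linarith
  have b23 : M * c₂₃ ≤ p₂ / 2 + M ^ 2 / 2 * p₃ := by
    have : |M * c₂₃| ≤ p₂ / 2 + M ^ 2 / 2 * p₃ := by
      refine abs_le_of_sq_le_sq ?_ (by positivity)
      calc (M * c₂₃) ^ 2 = M ^ 2 * c₂₃ ^ 2 := by ring
        _ ≤ M ^ 2 * (p₂ * p₃) := by gcongr
        _ ≤ _ := by linarith [sq_nonneg (p₂ - M ^ 2 * p₃)]
    exact (le_abs_self _).trans this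
  have b13 : 2 * c₁₃ ≤ R * N₁ / 2 + 2 * N₃ := by
    have : |2 * c₁₃| ≤ R * N₁ / 2 + 2 * N₃ := by
      refine abs_le_of_sq_le_sq ?_ (by positivity)
      calc (2 * c₁₃) ^ 2 = 4 * c₁₃ ^ 2 := by ring
        _ ≤ 4 * (N₁ * (R * N₃)) := by
            have : N₁ * p₃ ≤ N₁ * (R * N₃) := by gcongr
            linarith
        _ ≤ _ := by linarith [sq_nonneg (R * N₁ / 2 - 2 * N₃)]
    exact (le_abs_self _).trans this
  have main : (1 + R) * (K * (-2 * (R * N₂ - p₂) - 2 * γ * N₃)) +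
      (-p₂ - R * N₁ + M * c₂₃ + 2 * τ * γ * p₃ + 2 * c₁₃) ≤
        -(d * R * (N₁ + N₂ + τ * γ * N₃)) := by
    have e1 : 1 / 2 * (R * N₂ - p₂) ≤ 2 * K * (1 + R) * (R * N₂ - p₂) := by
      have h : (1 : ℝ) / 2 ≤ 2 * K * (1 + R) := by
        have : 0 ≤ K * R := by positivity
        linarith
      exact mul_le_mul_of_nonneg_right h (by linarith)
    have e2 : (M ^ 2 / 2 + 2 * τ * γ) * p₃ ≤ (M ^ 2 / 2 + 2 * τ * γ) * (R * N₃) := by gcongr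
    have e3 : (M ^ 2 / 2 + 2 * τ * γ + 2) * ((1 + R) * N₃) ≤ K * γ * ((1 + R) * N₃) := by gcongr
    have e4 : 0 ≤ (M ^ 2 / 2 + 2 * τ * γ) * N₃ := by positivity
    have e5 : 0 ≤ R * N₃ := by positivity
    have e6 : d * (R * N₁) ≤ 1 / 2 * (R * N₁) := by gcongr
    have e7 : d * (R * N₂) ≤ 1 / 2 * (R * N₂) := by gcongr
    have e8 : d * τ * (γ * (R * N₃)) ≤ K * (γ * (R * N₃)) := by gcongr
    have e9 : 0 ≤ K * γ * N₃ := by positivity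
    linarith
  have h : K * (-2 * (R * N₂ - p₂) - 2 * γ * N₃) +
      (-p₂ - R * N₁ + M * c₂₃ + 2 * τ * γ * p₃ + 2 * c₁₃) / (1 + R) =
      ((1 + R) * (K * (-2 * (R * N₂ - p₂) - 2 * γ * N₃)) +
      (-p₂ - R * N₁ + M * c₂₃ + 2 * τ * γ * p₃ + 2 * c₁₃)) / (1 + R) := by
    rw [eq_div_iff hR1.ne', add_mul, div_mul_cancel₀ _ hR1.ne']
    ring
  rw [h, div_le_iff₀ hR1]
  refine main.trans (le_of_eq ?_)
  field_simp

/-- The algebra behind the Lyapunov functional of the Moore-Gibson-Thompson system: `N₁`, `N₂`,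
`N₃` are the squared norms of the three parts of the vector, `p₂` and `p₃` those of the
longitudinal components (times the frequency), and the `c` are inner products. -/
theorem exists_lyapunov_constants {τ γ : ℝ} (hτ : 0 < τ) (hγ : 0 < γ) :
    ∃ K δ : ℝ, 0 < K ∧ 0 < δ ∧ ∀ R N₁ N₂ N₃ p₂ p₃ c₁₂ c₁₃ c₂₃ : ℝ, 0 ≤ R → 0 ≤ N₁ → 0 ≤ N₂ →
      0 ≤ N₃ → 0 ≤ p₂ → 0 ≤ p₃ → p₂ ≤ R * N₂ → p₃ ≤ R * N₃ →
      c₁₂ ^ 2 ≤ N₁ * p₂ → c₁₃ ^ 2 ≤ N₁ * p₃ → c₂₃ ^ 2 ≤ p₂ * p₃ →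
      K / 2 * (N₁ + N₂ + τ * γ * N₃) ≤
        K * (N₁ + N₂ + τ * γ * N₃) + (c₁₂ - 2 * τ * c₁₃) / (1 + R) ∧
      K * (N₁ + N₂ + τ * γ * N₃) + (c₁₂ - 2 * τ * c₁₃) / (1 + R) ≤
        2 * K * (N₁ + N₂ + τ * γ * N₃) ∧
      K * (-2 * (R * N₂ - p₂) - 2 * γ * N₃) +
        (-p₂ - R * N₁ + (2 * τ - γ) * c₂₃ + 2 * τ * γ * p₃ + 2 * c₁₃) / (1 + R) ≤
        -(δ * (R / (1 + R))) *
          (K * (N₁ + N₂ + τ * γ * N₃) + (c₁₂ - 2 * τ * c₁₃) / (1 + R)) := by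
  set M := 2 * τ - γ with hM
  set K := 2 + 2 * τ + 2 / γ + (M ^ 2 / 2 + 2 * τ * γ + 2) / γ with hK
  have hK1 : 2 + 2 * τ ≤ K := by
    have : 0 ≤ 2 / γ + (M ^ 2 / 2 + 2 * τ * γ + 2) / γ := by positivity
    linarith
  have hKγ : K * γ = (2 + 2 * τ) * γ + 2 + (M ^ 2 / 2 + 2 * τ * γ + 2) := by
    rw [hK]; field_simp
  have hτγ : 0 < τ * γ := mul_pos hτ hγ
  have hK2 : 2 ≤ K * γ := by linarith [sq_nonneg M]
  have hK3 : M ^ 2 / 2 + 2 * τ * γ + 2 ≤ K * γ := by linarith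
  clear_value K M
  have hK0 : 0 < K := by linarith
  set d := min (1 / 2) (K / τ) with hd
  have hd0 : 0 < d := lt_min (by norm_num) (by positivity)
  have hd1 : d ≤ 1 / 2 := min_le_left _ _
  have hd2 : d * τ ≤ K := (le_div_iff₀ hτ).mp (min_le_right (1 / 2) (K / τ))
  clear_value d
  refine ⟨K, d / (2 * K), hK0, by positivity, ?_⟩
  intro R N₁ N₂ N₃ p₂ p₃ c₁₂ c₁₃ c₂₃ hR h1 h2 h3 hp2 hp3 hp2N hp3N hc12 hc13 hc23
  have hcross := abs_lyapunov_cross_le hτ hK1 hK2 hR h1 h2 h3 hp2N hp3N hc12 hc13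
  have hdiss := lyapunov_dissipation_le hτ hγ (by linarith) hK3 hd1 hd2 hR h1 h2 h3 hp2 hp3 hp2N
    hp3N hc13 hc23
  rw [abs_le] at hcross
  have hE0 : 0 ≤ N₁ + N₂ + τ * γ * N₃ := by positivity
  generalize N₁ + N₂ + τ * γ * N₃ = E at *
  generalize (c₁₂ - 2 * τ * c₁₃) / (1 + R) = X at *
  have hKE : 0 ≤ K * E := by positivity
  have hLE : K * E + X ≤ 2 * K * E := by linarith [hcross.2]
  refine ⟨by linarith [hcross.1], hLE, hdiss.trans ?_⟩
  have hρ : 0 ≤ R / (1 + R) := by positivity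
  have h4 : d / (2 * K) * (R / (1 + R)) * (K * E + X) ≤
      d / (2 * K) * (R / (1 + R)) * (2 * K * E) := by gcongr
  have h5 : d / (2 * K) * (R / (1 + R)) * (2 * K * E) = d * (R / (1 + R)) * E := by
    field_simp
  linarith

/-- Gronwall's inequality for a decaying quantity. -/
theorem le_exp_mul_of_hasDerivAt_le {L L' : ℝ → ℝ} {c : ℝ} (hL : ∀ t, HasDerivAt L (L' t) t)
    (h : ∀ t, L' t ≤ -c * L t) {t : ℝ} (ht : 0 ≤ t) : L t ≤ Real.exp (-(c * t)) * L 0 := by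
  have hd : ∀ t, HasDerivAt (fun t => Real.exp (c * t) * L t)
      (Real.exp (c * t) * c * L t + Real.exp (c * t) * L' t) t := fun t => by
    have h1 : HasDerivAt (fun t => c * t) c t := by simpa using (hasDerivAt_id t).const_mul c
    exact h1.exp.mul (hL t)
  have hanti : Antitone fun t => Real.exp (c * t) * L t := by
    refine antitone_of_hasDerivAt_nonpos hd fun t => ?_
    have := mul_le_mul_of_nonneg_left (h t) (Real.exp_pos (c * t)).le
    simp only [Pi.zero_apply]
    linarith
  have h1 := hanti ht
  simp only [mul_zero, Real.exp_zero, one_mul] at h1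
  rw [Real.exp_neg, inv_mul_eq_div, le_div_iff₀ (Real.exp_pos _)]
  linarith

theorem Complex.real_inner_eq (z w : ℂ) : inner ℝ z w = z.re * w.re + z.im * w.im := by
  rw [Complex.inner]
  simp
  ring

theorem sq_real_inner_le (z w : ℂ) : (inner ℝ z w : ℝ) ^ 2 ≤ ‖z‖ ^ 2 * ‖w‖ ^ 2 := by
  rw [← mul_pow]
  exact sq_le_sq.mpr ((abs_real_inner_le_norm z w).trans (le_abs_self _))

theorem norm_sq_sum_mul_le (θ : Rn n) (b : Fin n → ℂ) :
    ‖∑ k, (θ k : ℂ) * b k‖ ^ 2 ≤ ‖θ‖ ^ 2 * ∑ k, ‖b k‖ ^ 2 := by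
  calc ‖∑ k, (θ k : ℂ) * b k‖ ^ 2 ≤ (∑ k, |θ k| * ‖b k‖) ^ 2 := by
        gcongr
        refine (norm_sum_le _ _).trans (le_of_eq ?_)
        simp
    _ ≤ (∑ k, |θ k| ^ 2) * ∑ k, ‖b k‖ ^ 2 := Finset.sum_mul_sq_le_sq_mul_sq _ _ _
    _ = _ := by rw [EuclideanSpace.norm_sq_eq]; simp

theorem hasDerivAt_sum_norm_sq {b : Fin n → ℝ → ℂ} {θ : Fin n → ℝ} {z : ℂ} {r t : ℝ}
    (hb : ∀ j, HasDerivAt (b j) ((θ j : ℂ) * z - (r : ℂ) * b j t) t) :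
    HasDerivAt (fun s => ∑ j, ‖b j s‖ ^ 2)
      (2 * inner ℝ z (∑ j, (θ j : ℂ) * b j t) - 2 * r * ∑ j, ‖b j t‖ ^ 2) t := by
  have h := HasDerivAt.fun_sum fun j (_ : j ∈ Finset.univ) => (hb j).norm_sq
  refine h.congr_deriv ?_
  rw [inner_sum, Finset.mul_sum, Finset.mul_sum, ← Finset.sum_sub_distrib]
  refine Finset.sum_congr rfl fun j _ => ?_
  rw [Complex.real_inner_eq, Complex.real_inner_eq, ← Complex.normSq_eq_norm_sq,
    Complex.normSq_apply]
  simp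
  ring

/-- The solutions of the ordinary differential equation of the Moore-Gibson-Thompson system at the
frequency `θ` decay exponentially, at a rate proportional to `|θ|² / (1 + |θ|²)`. -/
theorem exists_mgtSymbol_energy_decay {τ β : ℝ} (hτ : 0 < τ) (hβ : τ < β) :
    ∃ C δ : ℝ, 0 < C ∧ 0 < δ ∧ ∀ (n : ℕ) (θ : Rn n) (y : VIdx n → ℝ → ℂ),
      (∀ i t, HasDerivAt (y i) (∑ j, mgtSymbol τ β θ i j * y j t) t) → ∀ t, 0 ≤ t →
        ∑ i, ‖y i t‖ ^ 2 ≤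
          C * Real.exp (-(δ * (‖θ‖ ^ 2 / (1 + ‖θ‖ ^ 2)) * t)) * ∑ i, ‖y i 0‖ ^ 2 := by
  have hγ : 0 < β - τ := by linarith
  obtain ⟨K, δ, hK, hδ, hmain⟩ := exists_lyapunov_constants hτ hγ
  set γ := β - τ with hγdef
  set m := min 1 (τ * γ) with hm
  set M := max 1 (τ * γ) with hM
  have hm0 : 0 < m := lt_min one_pos (by positivity)
  have hM0 : 0 < M := lt_max_of_lt_left one_pos
  refine ⟨4 * M / m, δ, by positivity, hδ, fun n θ y hy t ht => ?_⟩
  set R := ‖θ‖ ^ 2 with hR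
  have hR0 : 0 ≤ R := by positivity
  have hR1 : 0 < 1 + R := by linarith
  set a : ℝ → ℂ := y (Sum.inl ()) with ha
  set b : Fin n → ℝ → ℂ := fun k => y (Sum.inr (Sum.inl k)) with hb
  set c : Fin n → ℝ → ℂ := fun k => y (Sum.inr (Sum.inr k)) with hc
  set S : ℝ → ℂ := fun t => ∑ k, (θ k : ℂ) * b k t with hS
  set T : ℝ → ℂ := fun t => ∑ k, (θ k : ℂ) * c k t with hT
  have hRsum : (R : ℂ) = ∑ k, (θ k : ℂ) * (θ k : ℂ) := by
    rw [hR, EuclideanSpace.norm_sq_eq]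
    push_cast
    refine Finset.sum_congr rfl fun k _ => ?_
    rw [Real.norm_eq_abs, ← sq, ← Complex.ofReal_pow, sq_abs, Complex.ofReal_pow]
  have hda : ∀ t, HasDerivAt a (Complex.I * S t + (γ : ℂ) * (Complex.I * T t)) t := fun t => by
    refine (hy (Sum.inl ()) t).congr_deriv ?_
    simp only [Fintype.sum_sum_type, mgtSymbol, hS, hT, hb, hc, Finset.mul_sum]
    simp [mul_assoc, hγdef]
  have hdb : ∀ j t, HasDerivAt (b j) ((θ j : ℂ) * (Complex.I * a t + S t) - (R : ℂ) * b j t) t :=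
    fun j t => by
    refine (hy (Sum.inr (Sum.inl j)) t).congr_deriv ?_
    simp only [Fintype.sum_sum_type, mgtSymbol, hS, ha, hb, sub_mul, Finset.sum_sub_distrib,
      mul_add, Finset.mul_sum, ite_mul, zero_mul, Finset.sum_ite_eq, Finset.mem_univ, if_true]
    simp [mul_assoc, hR]
    ring
  have hdc : ∀ j t, HasDerivAt (c j)
      ((θ j : ℂ) * ((τ⁻¹ : ℝ) * (Complex.I * a t)) - ((τ⁻¹ : ℝ) : ℂ) * c j t) t := fun j t => by
    refine (hy (Sum.inr (Sum.inr j)) t).congr_deriv ?_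
    simp only [Fintype.sum_sum_type, mgtSymbol, ha, hc, ite_mul, zero_mul, Finset.sum_ite_eq,
      Finset.mem_univ, if_true]
    simp
    ring
  have hdS : ∀ t, HasDerivAt S ((R : ℂ) * (Complex.I * a t)) t := fun t => by
    refine (HasDerivAt.fun_sum fun j (_ : j ∈ Finset.univ) =>
      (hdb j t).const_mul (θ j : ℂ)).congr_deriv ?_
    simp only [mul_sub, Finset.sum_sub_distrib, ← mul_assoc, ← Finset.sum_mul, ← hRsum]
    rw [Finset.sum_congr rfl fun j _ => by rw [mul_comm (θ j : ℂ) (R : ℂ), mul_assoc],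
      ← Finset.mul_sum]
    simp only [hS]
    ring
  have hdT : ∀ t, HasDerivAt T ((τ⁻¹ : ℝ) * ((R : ℂ) * (Complex.I * a t) - T t)) t := fun t => by
    refine (HasDerivAt.fun_sum fun j (_ : j ∈ Finset.univ) =>
      (hdc j t).const_mul (θ j : ℂ)).congr_deriv ?_
    simp only [mul_sub, Finset.sum_sub_distrib, ← mul_assoc, ← Finset.sum_mul, ← hRsum]
    rw [Finset.sum_congr rfl fun j _ => by rw [mul_comm (θ j : ℂ) ((τ⁻¹ : ℝ) : ℂ), mul_assoc],
      ← Finset.mul_sum]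
    simp only [hT]
    ring
  set N₁ : ℝ → ℝ := fun t => ‖a t‖ ^ 2 with hN1
  set N₂ : ℝ → ℝ := fun t => ∑ k, ‖b k t‖ ^ 2 with hN2
  set N₃ : ℝ → ℝ := fun t => ∑ k, ‖c k t‖ ^ 2 with hN3
  set c₁₂ : ℝ → ℝ := fun t => inner ℝ (a t) (-Complex.I * S t) with hc12
  set c₁₃ : ℝ → ℝ := fun t => inner ℝ (a t) (-Complex.I * T t) with hc13
  set c₂₃ : ℝ → ℝ := fun t => inner ℝ (S t) (T t) with hc23
  have hd1 : ∀ t, HasDerivAt N₁ (-2 * c₁₂ t - 2 * γ * c₁₃ t) t := fun t => by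
    refine (hda t).norm_sq.congr_deriv ?_
    simp only [hc12, hc13, Complex.real_inner_eq]
    simp
    ring
  have hd2 : ∀ t, HasDerivAt N₂ (2 * c₁₂ t - 2 * (R * N₂ t - ‖S t‖ ^ 2)) t := fun t => by
    refine (hasDerivAt_sum_norm_sq fun j => hdb j t).congr_deriv ?_
    have : inner ℝ (Complex.I * a t + S t) (S t) = c₁₂ t + ‖S t‖ ^ 2 := by
      simp only [hc12, Complex.real_inner_eq, ← Complex.normSq_eq_norm_sq, Complex.normSq_apply]
      simp
      ring
    rw [this]
    ring
  have hd3 : ∀ t, HasDerivAt N₃ (2 * τ⁻¹ * (c₁₃ t - N₃ t)) t := fun t => by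
    refine (hasDerivAt_sum_norm_sq fun j => hdc j t).congr_deriv ?_
    have : inner ℝ ((τ⁻¹ : ℝ) * (Complex.I * a t)) (T t) = τ⁻¹ * c₁₃ t := by
      simp only [hc13, Complex.real_inner_eq]
      simp [-Complex.ofReal_inv]
      ring
    rw [this]
    ring
  have hd12 : ∀ t, HasDerivAt c₁₂ (-‖S t‖ ^ 2 - γ * c₂₃ t + R * N₁ t) t := fun t => by
    refine ((hda t).inner ℝ ((hdS t).const_mul (-Complex.I))).congr_deriv ?_
    simp only [hc23, hN1, Complex.real_inner_eq, ← Complex.normSq_eq_norm_sq,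
      Complex.normSq_apply]
    simp
    ring
  have hd13 : ∀ t, HasDerivAt c₁₃ (-c₂₃ t - γ * ‖T t‖ ^ 2 + τ⁻¹ * (R * N₁ t - c₁₃ t)) t :=
    fun t => by
    refine ((hda t).inner ℝ ((hdT t).const_mul (-Complex.I))).congr_deriv ?_
    simp only [hc23, hc13, hN1, Complex.real_inner_eq, ← Complex.normSq_eq_norm_sq,
      Complex.normSq_apply]
    simp [-Complex.ofReal_inv]
    ring
  set E : ℝ → ℝ := fun t => N₁ t + N₂ t + τ * γ * N₃ t with hE
  set L : ℝ → ℝ := fun t => K * E t + (c₁₂ t - 2 * τ * c₁₃ t) / (1 + R) with hL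
  have hdL : ∀ t, HasDerivAt L (K * (-2 * (R * N₂ t - ‖S t‖ ^ 2) - 2 * γ * N₃ t) +
      (-‖S t‖ ^ 2 - R * N₁ t + (2 * τ - γ) * c₂₃ t + 2 * τ * γ * ‖T t‖ ^ 2 + 2 * c₁₃ t) /
        (1 + R)) t := fun t => by
    refine (((((hd1 t).add (hd2 t)).add ((hd3 t).const_mul (τ * γ))).const_mul K).add
      (((hd12 t).sub ((hd13 t).const_mul (2 * τ))).div_const (1 + R))).congr_deriv ?_
    field_simp
    ring
  have hprop : ∀ t, _ := fun t => hmain R (N₁ t) (N₂ t) (N₃ t) (‖S t‖ ^ 2) (‖T t‖ ^ 2) (c₁₂ t)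
    (c₁₃ t) (c₂₃ t) hR0 (by positivity) (Finset.sum_nonneg fun _ _ => by positivity)
    (Finset.sum_nonneg fun _ _ => by positivity) (by positivity) (by positivity)
    (norm_sq_sum_mul_le θ _) (norm_sq_sum_mul_le θ _)
    ((sq_real_inner_le _ _).trans (by simp [hN1])) ((sq_real_inner_le _ _).trans (by simp [hN1]))
    (sq_real_inner_le _ _)
  have hdecay := le_exp_mul_of_hasDerivAt_le hdL (fun t => (hprop t).2.2) ht
  have hsum : ∀ t, ∑ i, ‖y i t‖ ^ 2 = N₁ t + N₂ t + N₃ t := fun t => by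
    simp [Fintype.sum_sum_type, hN1, hN2, hN3, ha, hb, hc, add_assoc]
  have hN20 : ∀ t, 0 ≤ N₂ t := fun t => Finset.sum_nonneg fun _ _ => by positivity
  have hN30 : ∀ t, 0 ≤ N₃ t := fun t => Finset.sum_nonneg fun _ _ => by positivity
  have hlow : m * ∑ i, ‖y i t‖ ^ 2 ≤ E t := by
    rw [hsum]
    have e1 : m * (N₁ t + N₂ t) ≤ 1 * (N₁ t + N₂ t) := by
      have := hN20 t
      gcongr
      exact min_le_left _ _
    have e2 : m * N₃ t ≤ τ * γ * N₃ t := by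
      have := hN30 t
      gcongr
      exact min_le_right _ _
    simp only [hE]
    linarith
  have hupp : E 0 ≤ M * ∑ i, ‖y i 0‖ ^ 2 := by
    rw [hsum]
    have e1 : 1 * (N₁ 0 + N₂ 0) ≤ M * (N₁ 0 + N₂ 0) := by
      have := hN20 0
      gcongr
      exact le_max_left _ _
    have e2 : τ * γ * N₃ 0 ≤ M * N₃ 0 := by
      have := hN30 0
      gcongr
      exact le_max_right _ _
    simp only [hE]
    linarith
  have h1 : K / 2 * E t ≤ L t := (hprop t).1
  have h2 : L 0 ≤ 2 * K * E 0 := (hprop 0).2.1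
  set e := Real.exp (-(δ * (R / (1 + R)) * t)) with he
  have he0 : 0 < e := Real.exp_pos _
  have h3 : K / 2 * (m * ∑ i, ‖y i t‖ ^ 2) ≤ K / 2 * (4 * M * e * ∑ i, ‖y i 0‖ ^ 2) := by
    calc K / 2 * (m * ∑ i, ‖y i t‖ ^ 2) ≤ K / 2 * E t := by gcongr
      _ ≤ e * L 0 := h1.trans hdecay
      _ ≤ e * (2 * K * (M * ∑ i, ‖y i 0‖ ^ 2)) := by
          gcongr
          exact h2.trans (by gcongr)
      _ = _ := by ring
  have h4 := le_of_mul_le_mul_left h3 (by positivity)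
  rw [show 4 * M / m * e * ∑ i, ‖y i 0‖ ^ 2 = (4 * M * e * ∑ i, ‖y i 0‖ ^ 2) / m by ring,
    le_div_iff₀ hm0]
  linarith

/-- The exponential of the symbol of the Moore-Gibson-Thompson system decays at a rate proportional
to `|θ|² / (1 + |θ|²)`. -/
theorem exists_norm_exp_mgtSymbol_le {τ β : ℝ} (hτ : 0 < τ) (hβ : τ < β) :
    ∃ C δ : ℝ, 0 < C ∧ 0 < δ ∧ ∀ (n : ℕ) (θ : Rn n) (t : ℝ), 0 ≤ t → ∀ i j,
      ‖NormedSpace.exp (t • mgtSymbol τ β θ) i j‖ ≤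
        C * Real.exp (-(δ * (‖θ‖ ^ 2 / (1 + ‖θ‖ ^ 2)) * t)) := by
  obtain ⟨C, δ, hC, hδ, h⟩ := exists_mgtSymbol_energy_decay hτ hβ
  refine ⟨√C, δ / 2, Real.sqrt_pos.mpr hC, by positivity, fun n θ t ht i j => ?_⟩
  have h1 := h n θ (fun i t => NormedSpace.exp (t • mgtSymbol τ β θ) i j)
    (fun i t => Matrix.hasDerivAt_exp_real_smul_apply _ t i j) t ht
  have h0 : ∑ i, ‖NormedSpace.exp ((0 : ℝ) • mgtSymbol τ β θ) i j‖ ^ 2 = 1 := by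
    rw [zero_smul, NormedSpace.exp_zero, Finset.sum_eq_single j]
    · simp
    · intro k _ hk
      simp [Matrix.one_apply_ne hk]
    · simp
  rw [h0, mul_one] at h1
  refine abs_le_of_sq_le_sq' ?_ (by positivity) |>.2
  refine (Finset.single_le_sum (f := fun i => ‖NormedSpace.exp (t • mgtSymbol τ β θ) i j‖ ^ 2)
    (fun _ _ => by positivity) (Finset.mem_univ i)).trans (h1.trans (le_of_eq ?_))
  rw [mul_pow, Real.sq_sqrt hC.le, ← Real.exp_nat_mul]
  congr 2
  push_cast
  ring

end Symbol

section System

variable {n : ℕ}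

theorem hasTemperateGrowth_coord (k : Fin n) :
    (fun ξ : Rn n => ((((2 * Real.pi) • ξ : Rn n) k : ℝ) : ℂ)).HasTemperateGrowth :=
  (Complex.ofRealCLM ∘L (EuclideanSpace.proj k : Rn n →L[ℝ] ℝ) ∘L
    ((2 * Real.pi) • ContinuousLinearMap.id ℝ (Rn n))).hasTemperateGrowth

theorem hasTemperateGrowth_I_mul_coord (k : Fin n) :
    (fun ξ : Rn n => Complex.I * ((((2 * Real.pi) • ξ : Rn n) k : ℝ) : ℂ)).HasTemperateGrowth :=
  (Function.HasTemperateGrowth.const _).mul (hasTemperateGrowth_coord k)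

theorem hasTemperateGrowth_scaled_norm_sq :
    (fun ξ : Rn n => ((‖(2 * Real.pi) • ξ‖ ^ 2 : ℝ) : ℂ)).HasTemperateGrowth := by
  have h : (fun ξ : Rn n => ((‖(2 * Real.pi) • ξ‖ ^ 2 : ℝ) : ℂ)) = fun ξ =>
      ∑ k, ((((2 * Real.pi) • ξ : Rn n) k : ℝ) : ℂ) * ((((2 * Real.pi) • ξ : Rn n) k : ℝ) : ℂ) := by
    funext ξ
    rw [EuclideanSpace.norm_sq_eq]
    push_cast
    refine Finset.sum_congr rfl fun k _ => ?_
    rw [Real.norm_eq_abs, ← sq, ← Complex.ofReal_pow, sq_abs, Complex.ofReal_pow]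
  rw [h]
  exact Function.HasTemperateGrowth.sum fun k _ =>
    (hasTemperateGrowth_coord k).mul (hasTemperateGrowth_coord k)

theorem hasTemperateGrowth_mgtSymbol (τ β : ℝ) (i j : VIdx n) :
    (fun ξ : Rn n => mgtSymbol τ β ((2 * Real.pi) • ξ) i j).HasTemperateGrowth := by
  have hc := fun c : ℂ => Function.HasTemperateGrowth.const (E := Rn n) c
  have h1 := hasTemperateGrowth_coord (n := n)
  have h2 := hasTemperateGrowth_I_mul_coord (n := n)
  rcases i with i | i | i <;> rcases j with j | j | j <;> simp only [mgtSymbol]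
  · exact hc 0
  · exact h2 j
  · exact (hc _).mul (h2 j)
  · exact h2 i
  · refine ((h1 i).mul (h1 j)).sub ?_
    split_ifs
    · exact hasTemperateGrowth_scaled_norm_sq
    · exact hc 0
  · exact hc 0
  · exact (hc _).mul (h2 i)
  · exact hc 0
  · exact hc _

theorem fourier_lineDeriv_apply (f : TDist n) (k : Fin n) (ψ : 𝓢(Rn n, ℂ)) :
    (𝓕 (∂_{EuclideanSpace.single k (1 : ℝ)} f : TDist n) : TDist n) ψ =
      (𝓕 f : TDist n) (SchwartzMap.smulLeftCLM ℂ
      (fun ξ : Rn n => Complex.I * ((((2 * Real.pi) • ξ : Rn n) k : ℝ) : ℂ)) ψ) := by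
  have hg : (fun ξ : Rn n =>
      ((inner ℝ ξ (EuclideanSpace.single k (1 : ℝ)) : ℝ) : ℂ)).HasTemperateGrowth := by
    fun_prop
  rw [TemperedDistribution.fourier_lineDerivOp_eq, smul_apply,
    TemperedDistribution.smulLeftCLM_apply_apply, ← map_smul]
  congr 1
  ext ξ
  rw [smul_apply, SchwartzMap.smulLeftCLM_apply_apply hg,
    SchwartzMap.smulLeftCLM_apply_apply (hasTemperateGrowth_I_mul_coord k)]
  rw [real_inner_comm, EuclideanSpace.inner_single_left]
  simp
  ring

theorem smulLeftCLM_const_mul {g : Rn n → ℂ} (hg : g.HasTemperateGrowth) (c : ℂ)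
    (ψ : 𝓢(Rn n, ℂ)) : SchwartzMap.smulLeftCLM ℂ (fun ξ => c * g ξ) ψ =
      c • SchwartzMap.smulLeftCLM ℂ g ψ := by
  ext ξ
  have hcg : (fun ξ => c * g ξ).HasTemperateGrowth :=
    (Function.HasTemperateGrowth.const c).mul hg
  rw [SchwartzMap.smulLeftCLM_apply_apply hcg, smul_apply, SchwartzMap.smulLeftCLM_apply_apply hg]
  simp [mul_assoc]

/-- The Fourier transform of a gradient is annihilated by `|θ|² - θ θᵀ`. -/
theorem sum_fourier_lineDeriv_curl (p : TDist n) (j : Fin n) (ψ : 𝓢(Rn n, ℂ)) :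
    ∑ k, (𝓕 (∂_{EuclideanSpace.single k (1 : ℝ)} p : TDist n) : TDist n)
      (SchwartzMap.smulLeftCLM ℂ (fun ξ : Rn n =>
      ((((2 * Real.pi) • ξ : Rn n) j : ℝ) : ℂ) * ((((2 * Real.pi) • ξ : Rn n) k : ℝ) : ℂ) -
        if j = k then ((‖(2 * Real.pi) • ξ‖ ^ 2 : ℝ) : ℂ) else 0) ψ) = 0 := by
  have hg : ∀ k, (fun ξ : Rn n =>
      ((((2 * Real.pi) • ξ : Rn n) j : ℝ) : ℂ) * ((((2 * Real.pi) • ξ : Rn n) k : ℝ) : ℂ) -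
        if j = k then ((‖(2 * Real.pi) • ξ‖ ^ 2 : ℝ) : ℂ) else 0).HasTemperateGrowth := fun k =>
    hasTemperateGrowth_mgtSymbol 1 1 (Sum.inr (Sum.inl j)) (Sum.inr (Sum.inl k))
  simp_rw [fourier_lineDeriv_apply]
  rw [← map_sum]
  convert map_zero (𝓕 p : TDist n)
  ext ξ
  rw [sum_apply]
  simp_rw [SchwartzMap.smulLeftCLM_apply_apply (hasTemperateGrowth_I_mul_coord _),
    SchwartzMap.smulLeftCLM_apply_apply (hg _)]
  set θ : Rn n := (2 * Real.pi) • ξ with hθ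
  have hsum : ((‖θ‖ ^ 2 : ℝ) : ℂ) = ∑ k, (θ k : ℂ) * (θ k : ℂ) := by
    rw [EuclideanSpace.norm_sq_eq]
    push_cast
    refine Finset.sum_congr rfl fun k _ => ?_
    rw [Real.norm_eq_abs, ← sq, ← Complex.ofReal_pow, sq_abs, Complex.ofReal_pow]
  have h1 : ∀ k, (Complex.I * (θ k : ℂ)) • (((θ j : ℂ) * (θ k : ℂ) -
      if j = k then ((‖θ‖ ^ 2 : ℝ) : ℂ) else 0) • ψ ξ) =
      Complex.I * (θ j : ℂ) * ψ ξ * ((θ k : ℂ) * (θ k : ℂ)) -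
        if j = k then Complex.I * (θ k : ℂ) * ((‖θ‖ ^ 2 : ℝ) : ℂ) * ψ ξ else 0 := fun k => by
    split_ifs <;> simp only [smul_eq_mul] <;> ring
  simp_rw [h1]
  rw [Finset.sum_sub_distrib, ← Finset.mul_sum, ← hsum]
  simp
  ring

/-- The right-hand side of the first-order system satisfied by the vector
`(v + τ w, ∇(u + τ v), ∇ v)`. -/
theorem sum_fourier_mgtVector_symbol {τ : ℝ} (hτ : τ ≠ 0) (β : ℝ) (u v w : TDist n) (i : VIdx n)
    (ψ : 𝓢(Rn n, ℂ)) :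
    ∑ j, (𝓕 (mgtVector τ u v w j) : TDist n) (SchwartzMap.smulLeftCLM ℂ
      (fun ξ => mgtSymbol τ β ((2 * Real.pi) • ξ) i j) ψ) =
      (match i with
      | Sum.inl _ => Δ u + (β : ℂ) • Δ v
      | Sum.inr (Sum.inl j) => ∂_{EuclideanSpace.single j (1 : ℝ)} (v + (τ : ℂ) • w)
      | Sum.inr (Sum.inr j) => ∂_{EuclideanSpace.single j (1 : ℝ)} w : TDist n) (𝓕 ψ) := by
  have hlap : ∀ f : TDist n, (Δ f) (𝓕 ψ) =
      ∑ k, (𝓕 (∂_{EuclideanSpace.single k (1 : ℝ)} f : TDist n) : TDist n)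
      (SchwartzMap.smulLeftCLM ℂ
        (fun ξ : Rn n => Complex.I * ((((2 * Real.pi) • ξ : Rn n) k : ℝ) : ℂ)) ψ) := fun f => by
    rw [TemperedDistribution.laplacian_eq_sum (EuclideanSpace.basisFun (Fin n) ℝ)]
    simp_rw [← fourier_lineDeriv_apply, TemperedDistribution.fourier_apply]
    rw [sum_apply]
    simp
  have hI := hasTemperateGrowth_I_mul_coord (n := n)
  have hconst : ∀ (c : ℂ) (ψ : 𝓢(Rn n, ℂ)),
      SchwartzMap.smulLeftCLM ℂ (fun _ : Rn n => c) ψ = c • ψ := fun c ψ => by simp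
  rcases i with i | i | i
  · simp only [Fintype.sum_sum_type, mgtSymbol, mgtVector, smulLeftCLM_const_mul (hI _), hconst,
      zero_smul, map_zero, map_smul, ← Finset.smul_sum, Finset.sum_const_zero]
    simp only [← hlap, zero_add]
    simp
    ring
  · simp only [Fintype.sum_sum_type, mgtSymbol, mgtVector, sum_fourier_lineDeriv_curl, hconst,
      zero_smul, map_zero, Finset.sum_const_zero, ← fourier_lineDeriv_apply]
    simp
  · simp only [Fintype.sum_sum_type, mgtSymbol, mgtVector, smulLeftCLM_const_mul (hI _), hconst,
      zero_smul, map_zero, map_smul, Finset.sum_const_zero, ← fourier_lineDeriv_apply]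
    simp only [smul_eq_mul, ite_mul, zero_mul, Finset.sum_ite_eq, Finset.mem_univ, if_true]
    have hτ' : (τ : ℂ) ≠ 0 := Complex.ofReal_ne_zero.mpr hτ
    simp
    field_simp
    ring

theorem IsMGTSolution.continuousOn_fourier_mgtVector {τ β : ℝ} {u₀ u₁ u₂ : TDist n}
    {u v w : ℝ → TDist n} (h : IsMGTSolution τ β u₀ u₁ u₂ u v w) (i : VIdx n)
    (ψ : 𝓢(Rn n, ℂ)) :
    ContinuousOn (fun t => (𝓕 (mgtVector τ (u t) (v t) (w t) i) : TDist n) ψ) (Set.Ici 0) := by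
  rcases i with i | i | i
  · exact (h.cont_v (𝓕 ψ)).add (continuousOn_const.mul (h.cont_w (𝓕 ψ)))
  · exact (h.cont_u (-∂_{EuclideanSpace.single i (1 : ℝ)} (𝓕 ψ))).add
      (continuousOn_const.mul (h.cont_v (-∂_{EuclideanSpace.single i (1 : ℝ)} (𝓕 ψ))))
  · exact h.cont_v (-∂_{EuclideanSpace.single i (1 : ℝ)} (𝓕 ψ))

theorem IsMGTSolution.hasDerivAt_fourier_mgtVector {τ β : ℝ} (hτ : τ ≠ 0) {u₀ u₁ u₂ : TDist n}
    {u v w : ℝ → TDist n} (h : IsMGTSolution τ β u₀ u₁ u₂ u v w) (i : VIdx n)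
    (ψ : 𝓢(Rn n, ℂ)) (t : ℝ) (ht : 0 < t) :
    HasDerivAt (fun r => (𝓕 (mgtVector τ (u r) (v r) (w r) i) : TDist n) ψ)
      (∑ j, (𝓕 (mgtVector τ (u t) (v t) (w t) j) : TDist n) (SchwartzMap.smulLeftCLM ℂ
        (fun ξ => mgtSymbol τ β ((2 * Real.pi) • ξ) i j) ψ)) t := by
  rw [sum_fourier_mgtVector_symbol hτ]
  rcases i with i | i | i
  · refine ((h.deriv_v (𝓕 ψ) t ht).add (h.deriv_w (𝓕 ψ) t ht)).congr_deriv ?_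
    simp
  · exact (h.deriv_u (-∂_{EuclideanSpace.single i (1 : ℝ)} (𝓕 ψ)) t ht).add
      ((h.deriv_v (-∂_{EuclideanSpace.single i (1 : ℝ)} (𝓕 ψ)) t ht).const_mul (τ : ℂ))
  · exact h.deriv_v (-∂_{EuclideanSpace.single i (1 : ℝ)} (𝓕 ψ)) t ht

end System

section Plancherel

variable {n : ℕ}

/-- The Fourier transform of `f` is the square integrable function `H`. -/
def HasL2Fourier (f : TDist n) (H : Rn n → ℂ) : Prop :=
  MemLp H 2 (volume : Measure (Rn n)) ∧ ∀ ψ : 𝓢(Rn n, ℂ), (𝓕 f : TDist n) ψ = ∫ ξ, ψ ξ * H ξ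

theorem hasL2Fourier_iff {f : TDist n} {H : Rn n → ℂ} (hH : MemLp H 2 (volume : Measure (Rn n))) :
    HasL2Fourier f H ↔
      (𝓕 f : TDist n) = ((hH.toLp H : Lp ℂ 2 (volume : Measure (Rn n))) : TDist n) := by
  have key : ∀ ψ : 𝓢(Rn n, ℂ), ((hH.toLp H : Lp ℂ 2 (volume : Measure (Rn n))) : TDist n) ψ =
      ∫ ξ, ψ ξ * H ξ := fun ψ => by
    rw [Lp.toTemperedDistribution_apply]
    refine integral_congr_ae ?_
    filter_upwards [hH.coeFn_toLp] with ξ hξ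
    rw [hξ, smul_eq_mul]
  refine ⟨fun h => ?_, fun h => ⟨hH, fun ψ => by rw [h, key]⟩⟩
  ext ψ
  rw [h.2, key]

theorem Lp.toTemperedDistribution_injective {g g' : Lp ℂ 2 (volume : Measure (Rn n))}
    (h : (g : TDist n) = (g' : TDist n)) : g = g' := by
  have hinj := LinearMap.ker_eq_bot.mp
    (Lp.ker_toTemperedDistributionCLM_eq_bot (E := Rn n) (F := ℂ) (μ := volume) (p := 2))
  exact hinj h

theorem l2norm_coe (g : Lp ℂ 2 (volume : Measure (Rn n))) : l2norm (g : TDist n) = ‖g‖ₑ := by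
  refine le_antisymm (iInf₂_le (f := fun (g' : Lp ℂ 2 (volume : Measure (Rn n)))
    (_ : (g' : TDist n) = (g : TDist n)) => ‖g'‖ₑ) g rfl) (le_iInf₂ fun g' h => ?_)
  rw [Lp.toTemperedDistribution_injective h]

/-- Plancherel's theorem. -/
theorem HasL2Fourier.l2norm_eq {f : TDist n} {H : Rn n → ℂ} (h : HasL2Fourier f H) :
    l2norm f = eLpNorm H 2 volume := by
  have h1 := (hasL2Fourier_iff h.1).mp h
  have h2 : f = ((𝓕⁻ (h.1.toLp H) : Lp ℂ 2 (volume : Measure (Rn n))) : TDist n) := by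
    rw [← Lp.fourierInv_toTemperedDistribution_eq, ← h1, FourierTransform.fourierInv_fourier_eq]
  rw [h2, l2norm_coe, ← Lp.enorm_toLp h.1, ← ofReal_norm, ← ofReal_norm]
  congr 1
  rw [← Lp.norm_fourier_eq, FourierTransform.fourier_fourierInv_eq]

theorem exists_hasL2Fourier {f : TDist n} (h : l2norm f ≠ ⊤) : ∃ H, HasL2Fourier f H := by
  have : ∃ g : Lp ℂ 2 (volume : Measure (Rn n)), (g : TDist n) = f := by
    by_contra hne
    push Not at hne
    exact h (by simp [l2norm, hne])
  obtain ⟨g, rfl⟩ := this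
  refine ⟨_, (hasL2Fourier_iff (Lp.memLp (𝓕 g : Lp ℂ 2 (volume : Measure (Rn n))))).mpr ?_⟩
  rw [Lp.fourier_toTemperedDistribution_eq, Lp.toLp_coeFn]

/-- The inverse Fourier transform of a square integrable function, as a tempered distribution. -/
theorem exists_hasL2Fourier_of_memLp {H : Rn n → ℂ} (hH : MemLp H 2 (volume : Measure (Rn n))) :
    ∃ f : TDist n, HasL2Fourier f H :=
  ⟨𝓕⁻ ((hH.toLp H : Lp ℂ 2 (volume : Measure (Rn n))) : TDist n),
    (hasL2Fourier_iff hH).mpr (FourierTransform.fourier_fourierInv_eq _)⟩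

theorem fourier_multD_apply (m : Rn n → ℝ) (f : TDist n) (ψ : 𝓢(Rn n, ℂ)) :
    (𝓕 (multD m f) : TDist n) ψ = (𝓕 f : TDist n) (SchwartzMap.smulLeftCLM ℂ
      (fun ξ : Rn n => ((m ((2 * Real.pi) • ξ) : ℝ) : ℂ)) ψ) := by
  rw [multD, TemperedDistribution.fourierMultiplierCLM_apply,
    FourierTransform.fourier_fourierInv_eq, TemperedDistribution.smulLeftCLM_apply_apply]

/-- The function `m (2πξ)`, with complex values. -/
def scaledSymbol (m : Rn n → ℝ) (ξ : Rn n) : ℂ := ((m ((2 * Real.pi) • ξ) : ℝ) : ℂ)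

theorem contDiff_scaledSymbol {m : Rn n → ℝ} (hm : ContDiff ℝ ∞ m) :
    ContDiff ℝ ∞ (scaledSymbol m) :=
  Complex.ofRealCLM.contDiff.comp (hm.comp (contDiff_const_smul (2 * Real.pi)))

/-- The set of the `ξ` whose angular frequency `2πξ` lies in a shell. -/
def shell (n : ℕ) (a b : ℝ) : Set (Rn n) :=
  {ξ | a ≤ ‖(2 * Real.pi) • ξ‖ ∧ ‖(2 * Real.pi) • ξ‖ ≤ b}

theorem isCompact_shell (a b : ℝ) : IsCompact (shell n a b) := by
  refine Metric.isCompact_of_isClosed_isBounded ?_ ?_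
  · have hc : Continuous fun ξ : Rn n => ‖(2 * Real.pi) • ξ‖ := by fun_prop
    exact (isClosed_le continuous_const hc).inter (isClosed_le hc continuous_const)
  · refine (Metric.isBounded_closedBall (x := (0 : Rn n)) (r := b)).subset fun ξ hξ => ?_
    rw [mem_closedBall_zero_iff]
    have h2 := hξ.2
    rw [norm_smul, Real.norm_of_nonneg (by positivity)] at h2
    nlinarith [norm_nonneg ξ, Real.pi_gt_three]

theorem hasTemperateGrowth_scaledSymbol {m : Rn n → ℝ} (hm : ContDiff ℝ ∞ m) {a b : ℝ}
    (hs : Function.support m ⊆ {θ | a ≤ ‖θ‖ ∧ ‖θ‖ ≤ b}) :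
    (scaledSymbol m).HasTemperateGrowth ∧ Function.support (scaledSymbol m) ⊆ shell n a b := by
  have hsub : Function.support (scaledSymbol m) ⊆ shell n a b := fun ξ hξ =>
    hs (fun h0 => hξ (by simp [scaledSymbol, h0]))
  refine ⟨HasCompactSupport.hasTemperateGrowth ?_ (contDiff_scaledSymbol hm), hsub⟩
  exact HasCompactSupport.of_support_subset_isCompact (isCompact_shell a b) hsub

theorem HasL2Fourier.multD {m : Rn n → ℝ} (hm : (scaledSymbol m).HasTemperateGrowth) {A : ℝ}
    (hA : ∀ θ, |m θ| ≤ A) {f : TDist n} {H : Rn n → ℂ} (h : HasL2Fourier f H) :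
    HasL2Fourier (multD m f) fun ξ => scaledSymbol m ξ * H ξ := by
  refine ⟨h.1.of_le_mul (c := A) (hm.1.continuous.aestronglyMeasurable.mul h.1.1)
    (Eventually.of_forall fun ξ => ?_), fun ψ => ?_⟩
  · rw [norm_mul]
    gcongr
    rw [scaledSymbol, Complex.norm_real]
    exact hA _
  · rw [fourier_multD_apply, h.2]
    refine integral_congr_ae (Eventually.of_forall fun ξ => ?_)
    have := SchwartzMap.smulLeftCLM_apply_apply hm ψ ξ
    change SchwartzMap.smulLeftCLM ℂ (scaledSymbol m) ψ ξ * H ξ = ψ ξ * (scaledSymbol m ξ * H ξ)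
    rw [this, smul_eq_mul]
    ring

/-- If the product of a distribution with a function `κ` is a locally integrable function `H`, then
`H` vanishes almost everywhere outside of the support of `κ`. -/
theorem ae_eq_zero_of_smulLeftCLM_eq {Φ : TDist n} {κ : Rn n → ℂ} (hκ : κ.HasTemperateGrowth)
    {Z : Set (Rn n)} (hZ : IsClosed Z) (hκZ : Function.support κ ⊆ Z) {H : Rn n → ℂ}
    (hH : LocallyIntegrable H)
    (h : ∀ ψ : 𝓢(Rn n, ℂ), Φ (SchwartzMap.smulLeftCLM ℂ κ ψ) = ∫ ξ, ψ ξ * H ξ) :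
    ∀ᵐ ξ, ξ ∉ Z → H ξ = 0 := by
  refine hZ.isOpen_compl.ae_eq_zero_of_integral_contDiff_smul_eq_zero
    (hH.locallyIntegrableOn _) fun g hg hgc hgZ => ?_
  have hg₁ : HasCompactSupport (Complex.ofRealCLM ∘ g) := hgc.comp_left rfl
  have hg₂ : ContDiff ℝ ∞ (Complex.ofRealCLM ∘ g) := by fun_prop
  have h1 := h (hg₁.toSchwartzMap hg₂)
  have h0 : SchwartzMap.smulLeftCLM ℂ κ (hg₁.toSchwartzMap hg₂) = 0 := by
    ext ξ
    rw [SchwartzMap.smulLeftCLM_apply_apply hκ]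
    by_cases hξ : ξ ∈ Z
    · have : g ξ = 0 := by
        by_contra hne
        exact hgZ (subset_tsupport _ hne) hξ
      simp [this]
    · have : κ ξ = 0 := by
        by_contra hne
        exact hξ (hκZ hne)
      simp [this]
  rw [h0, map_zero] at h1
  rw [h1]
  refine integral_congr_ae (Eventually.of_forall fun ξ => ?_)
  simp

theorem monotoneOn_frequency_ratio {x y : ℝ} (hx : 0 ≤ x) (hxy : x ≤ y) :
    x ^ 2 / (1 + x ^ 2) ≤ y ^ 2 / (1 + y ^ 2) := by
  rw [div_le_div_iff₀ (by positivity) (by positivity)]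
  nlinarith [mul_self_le_mul_self hx hxy]

/-- The frequency-localized parts of the vector of a solution decay exponentially. -/
theorem exists_l2norm_multD_mgtVector_le {τ β : ℝ} (hτ : 0 < τ) (hβ : τ < β) :
    ∃ C δ : ℝ, 0 < C ∧ 0 < δ ∧ ∀ (n : ℕ) (u₀ u₁ u₂ : TDist n) (u v w : ℝ → TDist n),
      IsMGTSolution τ β u₀ u₁ u₂ u v w → ∀ (m : Rn n → ℝ) (a b : ℝ), ContDiff ℝ ∞ m → 0 ≤ a →
        Function.support m ⊆ {θ | a ≤ ‖θ‖ ∧ ‖θ‖ ≤ b} → ∀ t : ℝ, 0 ≤ t → ∀ i,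
          l2norm (multD m (mgtVector τ (u t) (v t) (w t) i)) ≤
            ENNReal.ofReal (C * Real.exp (-(δ * (a ^ 2 / (1 + a ^ 2)) * t))) *
              ∑ j, l2norm (multD m (mgtVector τ u₀ u₁ u₂ j)) := by
  obtain ⟨C, δ, hC, hδ, hexp⟩ := exists_norm_exp_mgtSymbol_le hτ hβ
  refine ⟨C, δ, hC, hδ, fun n u₀ u₁ u₂ u v w hsol m a b hm ha hs t ht i => ?_⟩
  set c := C * Real.exp (-(δ * (a ^ 2 / (1 + a ^ 2)) * t)) with hc
  have hc0 : 0 < c := by positivity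
  by_cases htop : ∑ j, l2norm (multD m (mgtVector τ u₀ u₁ u₂ j)) = ⊤
  · rw [htop, ENNReal.mul_top (by simpa using hc0)]
    exact le_top
  have hfin : ∀ j, l2norm (multD m (mgtVector τ u₀ u₁ u₂ j)) ≠ ⊤ := fun j hj =>
    htop (ENNReal.sum_eq_top.mpr ⟨j, Finset.mem_univ j, hj⟩)
  choose H hH using fun j => exists_hasL2Fourier (hfin j)
  obtain ⟨hκ, hκZ⟩ := hasTemperateGrowth_scaledSymbol hm hs
  have hZ := isCompact_shell (n := n) a b
  have hX : ∀ j (ψ : 𝓢(Rn n, ℂ)), (𝓕 (mgtVector τ (u 0) (v 0) (w 0) j) : TDist n)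
      (SchwartzMap.smulLeftCLM ℂ (scaledSymbol m) ψ) = ∫ ξ, ψ ξ * H j ξ := fun j ψ => by
    rw [hsol.init_u, hsol.init_v, hsol.init_w]
    exact (fourier_multD_apply m _ ψ).symm.trans ((hH j).2 ψ)
  have hHZ : ∀ j, ∀ᵐ ξ, ξ ∉ shell n a b → H j ξ = 0 := fun j =>
    ae_eq_zero_of_smulLeftCLM_eq hκ hZ.isClosed hκZ ((hH j).1.locallyIntegrable (by norm_num))
      (hX j)
  have hHi : ∀ j, Integrable (H j) := fun j => by
    refine IntegrableOn.integrable_of_ae_notMem_eq_zero (s := shell n a b) ?_ (hHZ j)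
    have : IsFiniteMeasure ((volume : Measure (Rn n)).restrict (shell n a b)) :=
      ⟨by rw [Measure.restrict_apply_univ]; exact hZ.measure_lt_top⟩
    exact ((hH j).1.restrict _).integrable (by norm_num)
  have hflow := flow_eq_integral_exp
    (B := fun ξ => mgtSymbol τ β ((2 * Real.pi) • ξ))
    (X := fun i t => 𝓕 (mgtVector τ (u t) (v t) (w t) i)) (hasTemperateGrowth_mgtSymbol τ β)
    hsol.continuousOn_fourier_mgtVector (hsol.hasDerivAt_fourier_mgtVector hτ.ne') hκ hZ hκZ hHi hHZ
    hX ht i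
  have hmeas : ∀ j, AEStronglyMeasurable
      (fun ξ => NormedSpace.exp (t • mgtSymbol τ β ((2 * Real.pi) • ξ)) i j * H j ξ) volume :=
    fun j => (Matrix.continuous_exp_smul_apply
      (fun i j => (hasTemperateGrowth_mgtSymbol τ β i j).1.continuous) t i
      j).aestronglyMeasurable.mul (hH j).1.1
  have hpt : ∀ j, ∀ᵐ ξ, ‖NormedSpace.exp (t • mgtSymbol τ β ((2 * Real.pi) • ξ)) i j * H j ξ‖ ≤
      c * ‖H j ξ‖ := fun j => by
    filter_upwards [hHZ j] with ξ hξ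
    by_cases hz : ξ ∈ shell n a b
    · rw [norm_mul]
      gcongr
      refine (hexp n _ t ht i j).trans ?_
      rw [hc]
      gcongr C * Real.exp (-(δ * ?_ * t))
      exact monotoneOn_frequency_ratio ha hz.1
    · simp [hξ hz]
  have hG : HasL2Fourier (multD m (mgtVector τ (u t) (v t) (w t) i)) fun ξ =>
      ∑ j, NormedSpace.exp (t • mgtSymbol τ β ((2 * Real.pi) • ξ)) i j * H j ξ :=
    ⟨memLp_finsetSum _ fun j _ => (hH j).1.of_le_mul (hmeas j) (hpt j), fun ψ =>
      (fourier_multD_apply m _ ψ).trans (hflow ψ)⟩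
  rw [hG.l2norm_eq, Finset.mul_sum]
  have : (fun ξ => ∑ j, NormedSpace.exp (t • mgtSymbol τ β ((2 * Real.pi) • ξ)) i j * H j ξ) =
      ∑ j, fun ξ => NormedSpace.exp (t • mgtSymbol τ β ((2 * Real.pi) • ξ)) i j * H j ξ := by
    funext ξ
    rw [Finset.sum_apply]
  rw [this]
  refine (eLpNorm_sum_le (fun j _ => hmeas j) (by norm_num)).trans
    (Finset.sum_le_sum fun j _ => ?_)
  rw [(hH j).l2norm_eq]
  exact eLpNorm_le_mul_eLpNorm_of_ae_le_mul (hpt j) 2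

end Plancherel

section DyadicSums

theorem two_rpow_intCast_mul (q : ℤ) (α : ℝ) : (2 : ℝ) ^ ((q : ℝ) * α) = ((2 : ℝ) ^ q) ^ α := by
  rw [Real.rpow_mul (by norm_num), Real.rpow_intCast]

/-- Gaussian decay beats powers, uniformly for the exponents in a bounded interval. -/
theorem exists_rpow_mul_exp_neg_sq_le {c : ℝ} (hc : 0 < c) (s S : ℝ) :
    ∃ K : ℝ, 1 ≤ K ∧ ∀ α : ℝ, α ≤ S → ∀ x : ℝ, 1 ≤ x →
      x ^ α * Real.exp (-(c * x ^ 2)) ≤ K * x ^ (-s) := by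
  obtain ⟨m, hm⟩ := exists_nat_ge (S + s)
  refine ⟨max 1 (m.factorial / c ^ m), le_max_left _ _, fun α hα x hx => ?_⟩
  have hx0 : 0 < x := by linarith
  have h1 : x ^ (α + s) ≤ (x ^ 2) ^ m := by
    calc x ^ (α + s) ≤ x ^ ((2 * m : ℕ) : ℝ) := by
          refine Real.rpow_le_rpow_of_exponent_le hx ?_
          push_cast
          linarith [m.cast_nonneg (α := ℝ)]
      _ = (x ^ 2) ^ m := by rw [Real.rpow_natCast, pow_mul]
  have h2 : (c * x ^ 2) ^ m / m.factorial ≤ Real.exp (c * x ^ 2) :=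
    Real.pow_div_factorial_le_exp _ (by positivity) m
  have h3 : (x ^ 2) ^ m * Real.exp (-(c * x ^ 2)) ≤ m.factorial / c ^ m := by
    rw [Real.exp_neg, ← div_eq_mul_inv, div_le_div_iff₀ (by positivity) (by positivity)]
    rw [div_le_iff₀ (by positivity), mul_pow] at h2
    linarith
  calc x ^ α * Real.exp (-(c * x ^ 2))
      = (x ^ (α + s) * Real.exp (-(c * x ^ 2))) * x ^ (-s) := by
        have : x ^ α = x ^ (α + s) * x ^ (-s) := by
          rw [← Real.rpow_add hx0]
          ring_nf
        rw [this]
        ring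
    _ ≤ (max 1 (m.factorial / c ^ m)) * x ^ (-s) := by
        gcongr
        exact ((mul_le_mul_of_nonneg_right h1 (Real.exp_nonneg _)).trans h3).trans
          (le_max_right _ _)

theorem summable_two_rpow_neg_abs {s : ℝ} (hs : 0 < s) :
    Summable fun q : ℤ => (2 : ℝ) ^ (-(s * |(q : ℝ)|)) := by
  have h : Summable fun m : ℕ => ((2 : ℝ) ^ (-s)) ^ m :=
    summable_geometric_of_lt_one (by positivity) (Real.rpow_lt_one_of_one_lt_of_neg (by norm_num)
      (by linarith))
  have h' : ∀ m : ℕ, (2 : ℝ) ^ (-(s * (m : ℝ))) = ((2 : ℝ) ^ (-s)) ^ m := fun m => by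
    rw [← Real.rpow_natCast, ← Real.rpow_mul (by norm_num)]
    ring_nf
  refine Summable.of_nat_of_neg ?_ ?_ <;> simpa [h'] using h

/-- The dyadic sum of the low-frequency decay rates, uniformly for the exponents in a compact
subinterval of `(0, ∞)`. -/
theorem exists_tsum_two_rpow_mul_exp_le {c : ℝ} (hc : 0 < c) {s : ℝ} (hs : 0 < s) (S : ℝ) :
    ∃ C : ℝ, 0 < C ∧ ∀ α : ℝ, s ≤ α → α ≤ S → ∀ T : ℝ, 0 < T →
      ∑' q : ℤ, ENNReal.ofReal ((2 : ℝ) ^ ((q : ℝ) * α) * Real.exp (-(c * ((2 : ℝ) ^ q) ^ 2 * T)))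
        ≤ ENNReal.ofReal (C * T ^ (-(α / 2))) := by
  obtain ⟨K, hK, hKx⟩ := exists_rpow_mul_exp_neg_sq_le hc s S
  have hsum := summable_two_rpow_neg_abs hs
  have hpos : 0 < ∑' q : ℤ, (2 : ℝ) ^ (-(s * |(q : ℝ)|)) :=
    hsum.tsum_pos (fun q => by positivity) 0 (by positivity)
  refine ⟨K * 2 ^ s * ∑' q : ℤ, (2 : ℝ) ^ (-(s * |(q : ℝ)|)), by positivity,
    fun α hsα hαS T hT => ?_⟩
  obtain ⟨p, hp1, hp2⟩ := exists_mem_Ico_zpow (x := √T) (y := (2 : ℝ)) (by positivity) (by norm_num)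
  have hterm : ∀ q : ℤ,
      (2 : ℝ) ^ ((q : ℝ) * α) * Real.exp (-(c * ((2 : ℝ) ^ q) ^ 2 * T)) ≤
        (K * 2 ^ s * T ^ (-(α / 2))) * 2 ^ (-(s * |((q + p : ℤ) : ℝ)|)) := fun q => by
    set x := (2 : ℝ) ^ q * √T with hx
    have hx0 : 0 < x := by positivity
    have hlow : (2 : ℝ) ^ (((q + p : ℤ) : ℝ)) ≤ x := by
      rw [Real.rpow_intCast, zpow_add₀ (by norm_num)]
      exact mul_le_mul_of_nonneg_left hp1 (by positivity)
    have hupp : x ≤ (2 : ℝ) ^ (((q + p : ℤ) : ℝ) + 1) := by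
      rw [Real.rpow_add (by norm_num), Real.rpow_intCast, zpow_add₀ (by norm_num), mul_assoc,
        Real.rpow_one, ← zpow_add_one₀ (by norm_num)]
      exact mul_le_mul_of_nonneg_left hp2.le (by positivity)
    have hmain : x ^ α * Real.exp (-(c * x ^ 2)) ≤
        K * (2 ^ s * 2 ^ (-(s * |((q + p : ℤ) : ℝ)|))) := by
      rw [← Real.rpow_add (by norm_num)]
      rcases le_total x 1 with h1 | h1
      · have hα : x ^ α ≤ x ^ s := Real.rpow_le_rpow_of_exponent_ge hx0 h1 hsα
        have hneg : ((q + p : ℤ) : ℝ) ≤ 0 := by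
          have := hlow.trans h1
          by_contra hcon
          exact absurd this (not_le.mpr (Real.one_lt_rpow (by norm_num) (not_le.mp hcon)))
        have hxs : x ^ s ≤ 2 ^ (s + -(s * |((q + p : ℤ) : ℝ)|)) := by
          calc x ^ s ≤ ((2 : ℝ) ^ (((q + p : ℤ) : ℝ) + 1)) ^ s :=
                Real.rpow_le_rpow hx0.le hupp hs.le
            _ = 2 ^ (s + -(s * |((q + p : ℤ) : ℝ)|)) := by
                rw [← Real.rpow_mul (by norm_num), abs_of_nonpos hneg]
                ring_nf
        calc x ^ α * Real.exp (-(c * x ^ 2)) ≤ x ^ s * 1 := by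
              gcongr
              exact Real.exp_le_one_iff.mpr (by simp; positivity)
          _ ≤ K * 2 ^ (s + -(s * |((q + p : ℤ) : ℝ)|)) := by
              rw [mul_one]
              exact hxs.trans (le_mul_of_one_le_left (by positivity) hK)
      · have hbd := hKx α hαS x h1
        have hxs : x ^ (-s) ≤ 2 ^ (s + -(s * |((q + p : ℤ) : ℝ)|)) := by
          rcases le_total 0 ((q + p : ℤ) : ℝ) with h0 | h0
          · calc x ^ (-s) ≤ ((2 : ℝ) ^ (((q + p : ℤ) : ℝ))) ^ (-s) :=
                  Real.rpow_le_rpow_of_nonpos (by positivity) hlow (by linarith)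
              _ ≤ 2 ^ (s + -(s * |((q + p : ℤ) : ℝ)|)) := by
                  rw [← Real.rpow_mul (by norm_num), abs_of_nonneg h0]
                  exact Real.rpow_le_rpow_of_exponent_le (by norm_num) (by linarith)
          · have hm1 : (0 : ℝ) ≤ ((q + p : ℤ) : ℝ) + 1 := by
              by_contra hcon
              exact absurd (h1.trans hupp) (not_le.mpr
                (Real.rpow_lt_one_of_one_lt_of_neg (by norm_num) (not_le.mp hcon)))
            calc x ^ (-s) ≤ 1 := Real.rpow_le_one_of_one_le_of_nonpos h1 (by linarith)
              _ ≤ 2 ^ (s + -(s * |((q + p : ℤ) : ℝ)|)) := by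
                  refine Real.one_le_rpow (by norm_num) ?_
                  rw [abs_of_nonpos h0]
                  nlinarith
        exact hbd.trans (mul_le_mul_of_nonneg_left hxs (by linarith))
    have hsqrt : √T ^ α * T ^ (-(α / 2)) = 1 := by
      rw [Real.sqrt_eq_rpow, ← Real.rpow_mul hT.le, ← Real.rpow_add hT]
      ring_nf
      exact Real.rpow_zero T
    calc (2 : ℝ) ^ ((q : ℝ) * α) * Real.exp (-(c * ((2 : ℝ) ^ q) ^ 2 * T))
        = (x ^ α * Real.exp (-(c * x ^ 2))) * T ^ (-(α / 2)) := by
          rw [two_rpow_intCast_mul, hx, mul_pow, Real.sq_sqrt hT.le,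
            Real.mul_rpow (by positivity) (by positivity), ← mul_assoc c]
          linear_combination (-((2 : ℝ) ^ q) ^ α *
            Real.exp (-(c * ((2 : ℝ) ^ q) ^ 2 * T))) * hsqrt
      _ ≤ (K * (2 ^ s * 2 ^ (-(s * |((q + p : ℤ) : ℝ)|)))) * T ^ (-(α / 2)) := by gcongr
      _ = _ := by ring
  have hshift : Summable fun q : ℤ => (2 : ℝ) ^ (-(s * |((q + p : ℤ) : ℝ)|)) :=
    (Equiv.addRight p).summable_iff.mpr hsum
  have hshift' : ∑' q : ℤ, (2 : ℝ) ^ (-(s * |((q + p : ℤ) : ℝ)|)) =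
      ∑' q : ℤ, (2 : ℝ) ^ (-(s * |(q : ℝ)|)) :=
    (Equiv.addRight p).tsum_eq fun q : ℤ => (2 : ℝ) ^ (-(s * |(q : ℝ)|))
  refine (ENNReal.tsum_le_tsum fun q => ENNReal.ofReal_le_ofReal (hterm q)).trans ?_
  rw [← ENNReal.ofReal_tsum_of_nonneg (fun q => by positivity) (hshift.mul_left _), tsum_mul_left,
    hshift']
  exact ENNReal.ofReal_le_ofReal (by linarith)

end DyadicSums

section Blocks

variable {n : ℕ}

theorem LPPair.contDiff_dilate (P : LPPair n) (q : ℤ) :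
    ContDiff ℝ ∞ fun ξ => P.φ ((2 : ℝ) ^ (-q) • ξ) :=
  P.φ_smooth.comp (contDiff_const_smul _)

theorem LPPair.support_dilate_subset (P : LPPair n) (q : ℤ) :
    (Function.support fun ξ => P.φ ((2 : ℝ) ^ (-q) • ξ)) ⊆
      {θ | 3 / 4 * (2 : ℝ) ^ q ≤ ‖θ‖ ∧ ‖θ‖ ≤ 8 / 3 * (2 : ℝ) ^ q} := fun θ hθ => by
  obtain ⟨h1, h2⟩ := P.φ_supp hθ
  have hq : (0 : ℝ) < 2 ^ q := by positivity
  rw [norm_smul, norm_zpow, Real.norm_ofNat, zpow_neg] at h1 h2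
  rw [inv_mul_eq_div] at h1 h2
  exact ⟨(le_div_iff₀ hq).mp h1, (div_le_iff₀ hq).mp h2⟩

theorem LPPair.abs_φ_le (P : LPPair n) (θ : Rn n) : |P.φ θ| ≤ 1 :=
  abs_le.mpr ⟨by linarith [(P.φ_mem θ).1], (P.φ_mem θ).2⟩

/-- Decay of the dyadic blocks of the vector of a solution. -/
theorem LPPair.exists_l2norm_block_mgtVector_le (P : LPPair n) {τ β : ℝ} (hτ : 0 < τ)
    (hβ : τ < β) :
    ∃ C c : ℝ, 0 < C ∧ 0 < c ∧ ∀ (u₀ u₁ u₂ : TDist n) (u v w : ℝ → TDist n),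
      IsMGTSolution τ β u₀ u₁ u₂ u v w → ∀ t : ℝ, 0 ≤ t → ∀ (i : VIdx n) (q : ℤ),
        l2norm (P.block q (mgtVector τ (u t) (v t) (w t) i)) ≤
          ENNReal.ofReal
              (C * Real.exp (-(c * (if 0 ≤ q then 1 else ((2 : ℝ) ^ q) ^ 2) * (1 + t)))) *
            ∑ j, l2norm (P.block q (mgtVector τ u₀ u₁ u₂ j)) := by
  obtain ⟨C, δ, hC, hδ, h⟩ := exists_l2norm_multD_mgtVector_le hτ hβ
  refine ⟨C * Real.exp (9 / 25 * δ), 9 / 25 * δ, by positivity, by positivity,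
    fun u₀ u₁ u₂ u v w hsol t ht i q => ?_⟩
  refine (h n u₀ u₁ u₂ u v w hsol _ _ _ (P.contDiff_dilate q) (by positivity)
    (P.support_dilate_subset q) t ht i).trans ?_
  refine mul_le_mul_left (ENNReal.ofReal_le_ofReal ?_) _
  rw [mul_assoc C (Real.exp _), ← Real.exp_add]
  gcongr
  set ρ : ℝ := if 0 ≤ q then 1 else ((2 : ℝ) ^ q) ^ 2 with hρ
  set a := 3 / 4 * (2 : ℝ) ^ q with ha
  have hq : (0 : ℝ) < 2 ^ q := by positivity
  have hρa : ρ ≤ 1 ∧ 9 / 25 * ρ ≤ a ^ 2 / (1 + a ^ 2) := by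
    rw [le_div_iff₀ (by positivity)]
    rw [hρ, ha]
    split_ifs with h0
    · have : (1 : ℝ) ≤ 2 ^ q := one_le_zpow₀ (by norm_num) h0
      refine ⟨le_rfl, ?_⟩
      nlinarith
    · have h1 : (2 : ℝ) ^ q ≤ 1 := zpow_le_one_of_nonpos₀ (by norm_num) (by omega)
      have h2 : ((2 : ℝ) ^ q) ^ 2 ≤ 1 := pow_le_one₀ hq.le h1
      refine ⟨h2, ?_⟩
      nlinarith [mul_nonneg (sq_nonneg ((2 : ℝ) ^ q)) (sub_nonneg.mpr h2)]
  nlinarith [mul_nonneg (mul_nonneg hδ.le ht) (sub_nonneg.mpr hρa.2),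
    mul_nonneg hδ.le (sub_nonneg.mpr hρa.1)]

theorem LPPair.sum_l2norm_block_le (P : LPPair n) (s : ℝ) (V : VIdx n → TDist n) (q : ℤ) :
    ∑ i, l2norm (P.block q (V i)) ≤
      ENNReal.ofReal ((2 : ℝ) ^ ((q : ℝ) * s)) * ∑ i, P.homNormInf (-s) (V i) := by
  rw [Finset.mul_sum]
  refine Finset.sum_le_sum fun i _ => ?_
  have h : ENNReal.ofReal ((2 : ℝ) ^ ((q : ℝ) * -s)) * l2norm (P.block q (V i)) ≤
      P.homNormInf (-s) (V i) :=
    le_iSup (fun q : ℤ => ENNReal.ofReal ((2 : ℝ) ^ ((q : ℝ) * -s)) * l2norm (P.block q (V i))) q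
  calc l2norm (P.block q (V i))
      = ENNReal.ofReal ((2 : ℝ) ^ ((q : ℝ) * s)) *
        (ENNReal.ofReal ((2 : ℝ) ^ ((q : ℝ) * -s)) * l2norm (P.block q (V i))) := by
        rw [← mul_assoc, ← ENNReal.ofReal_mul (by positivity), ← Real.rpow_add (by norm_num)]
        simp
    _ ≤ _ := by gcongr

theorem LPPair.tsum_sum_l2norm_block (P : LPPair n) (σ : ℝ) (V : VIdx n → TDist n) :
    ∑' q : ℤ, ENNReal.ofReal ((2 : ℝ) ^ ((q : ℝ) * σ)) * ∑ i, l2norm (P.block q (V i)) =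
      ∑ i, P.homNormOne σ (V i) := by
  simp only [Finset.mul_sum, LPPair.homNormOne]
  exact Summable.tsum_finsetSum fun i _ => ENNReal.summable

/-- Decay of the vector of a solution in the norms that have the regularity `σ` for the high
frequencies and the regularity `k ≤ σ` for the low ones. -/
theorem LPPair.exists_tsum_l2norm_block_mgtVector_le (P : LPPair n) {τ β : ℝ} (hτ : 0 < τ)
    (hβ : τ < β) (σ : ℝ) {s k₀ : ℝ} (hk₀ : 0 < k₀ + s) :
    ∃ C : ℝ, 0 < C ∧ ∀ (u₀ u₁ u₂ : TDist n) (u v w : ℝ → TDist n),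
      IsMGTSolution τ β u₀ u₁ u₂ u v w → ∀ k : ℝ, k₀ ≤ k → k ≤ σ → ∀ t : ℝ, 0 ≤ t → ∀ i,
        ∑' q : ℤ, ENNReal.ofReal ((2 : ℝ) ^ ((q : ℝ) * if 0 ≤ q then σ else k)) *
            l2norm (P.block q (mgtVector τ (u t) (v t) (w t) i)) ≤
          ENNReal.ofReal (C * (1 + t) ^ (-((k + s) / 2))) *
            P.dataNorm σ s (mgtVector τ u₀ u₁ u₂) := by
  obtain ⟨C, c, hC, hc, hblock⟩ := P.exists_l2norm_block_mgtVector_le hτ hβ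
  obtain ⟨K, hK, hKx⟩ := exists_rpow_mul_exp_neg_sq_le hc 0 (σ + s)
  obtain ⟨C', hC', hsum⟩ := exists_tsum_two_rpow_mul_exp_le hc hk₀ (σ + s)
  refine ⟨C * K + C * C', by positivity, fun u₀ u₁ u₂ u v w hsol k hk hkσ t ht i => ?_⟩
  set V := mgtVector τ u₀ u₁ u₂
  set D := P.dataNorm σ s V
  set T := 1 + t with hT
  have hT1 : 1 ≤ T := by linarith
  have hexp : Real.exp (-(c * T)) ≤ K * T ^ (-((k + s) / 2)) := by
    have h := hKx (k + s) (by linarith) √T (Real.one_le_sqrt.mpr hT1)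
    rw [Real.sq_sqrt (by linarith), neg_zero, Real.rpow_zero, mul_one, Real.sqrt_eq_rpow,
      ← Real.rpow_mul (by linarith), mul_comm] at h
    rw [Real.rpow_neg (by linarith), ← div_eq_mul_inv, le_div_iff₀ (by positivity)]
    rwa [show (k + s) / 2 = 1 / 2 * (k + s) by ring]
  have hterm : ∀ q : ℤ, ENNReal.ofReal ((2 : ℝ) ^ ((q : ℝ) * if 0 ≤ q then σ else k)) *
        l2norm (P.block q (mgtVector τ (u t) (v t) (w t) i)) ≤
      ENNReal.ofReal (C * Real.exp (-(c * T))) *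
          (ENNReal.ofReal ((2 : ℝ) ^ ((q : ℝ) * σ)) * ∑ j, l2norm (P.block q (V j))) +
        ENNReal.ofReal C * D * ENNReal.ofReal
          ((2 : ℝ) ^ ((q : ℝ) * (k + s)) * Real.exp (-(c * ((2 : ℝ) ^ q) ^ 2 * T))) := fun q => by
    have h := hblock u₀ u₁ u₂ u v w hsol t ht i q
    split_ifs with h0
    · rw [if_pos h0, mul_one] at h
      refine le_add_right ?_
      rw [mul_left_comm]
      gcongr
    · rw [if_neg h0] at h
      refine le_add_left ?_
      calc _ ≤ ENNReal.ofReal ((2 : ℝ) ^ ((q : ℝ) * k)) *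
            (ENNReal.ofReal (C * Real.exp (-(c * ((2 : ℝ) ^ q) ^ 2 * T))) *
              (ENNReal.ofReal ((2 : ℝ) ^ ((q : ℝ) * s)) * D)) := by
            refine mul_le_mul_right (h.trans (mul_le_mul_right ?_ _)) _
            exact (P.sum_l2norm_block_le s V q).trans (mul_le_mul_right le_add_self _)
        _ = _ := by
            rw [mul_add (q : ℝ), Real.rpow_add (by norm_num), ENNReal.ofReal_mul hC.le,
              ENNReal.ofReal_mul (by positivity), ENNReal.ofReal_mul (by positivity)]
            ring
  refine (ENNReal.tsum_le_tsum hterm).trans ?_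
  rw [ENNReal.tsum_add, ENNReal.tsum_mul_left, ENNReal.tsum_mul_left, P.tsum_sum_l2norm_block]
  calc _ ≤ ENNReal.ofReal (C * (K * T ^ (-((k + s) / 2)))) * D +
        ENNReal.ofReal C * D * ENNReal.ofReal (C' * T ^ (-((k + s) / 2))) := by
        gcongr
        · exact le_self_add
        · exact hsum (k + s) (by linarith) (by linarith) T (by linarith)
    _ = _ := by
        rw [mul_right_comm, ← ENNReal.ofReal_mul hC.le, ← add_mul,
          ← ENNReal.ofReal_add (by positivity) (by positivity)]
        ring_nf

end Blocks

section LowFrequencies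

variable {n : ℕ}

theorem LPPair.tsum_l2norm_block_ne_top (P : LPPair n) {σ s : ℝ} (hσ : 0 ≤ σ) (hs : 0 < s)
    {f : TDist n} (h₁ : P.homNormOne σ f ≠ ⊤) (h₂ : P.homNormInf (-s) f ≠ ⊤) :
    ∑' q : ℤ, l2norm (P.block q f) ≠ ⊤ := by
  have hterm : ∀ q : ℤ, l2norm (P.block q f) ≤
      ENNReal.ofReal ((2 : ℝ) ^ ((q : ℝ) * σ)) * l2norm (P.block q f) +
        ENNReal.ofReal ((2 : ℝ) ^ (-(s * |(q : ℝ)|))) * P.homNormInf (-s) f := fun q => by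
    rcases le_total 0 (q : ℝ) with hq | hq
    · refine le_add_right (le_mul_of_one_le_left zero_le ?_)
      rw [← ENNReal.ofReal_one]
      exact ENNReal.ofReal_le_ofReal (Real.one_le_rpow (by norm_num) (by positivity))
    · refine le_add_left ?_
      have h : ENNReal.ofReal ((2 : ℝ) ^ ((q : ℝ) * -s)) * l2norm (P.block q f) ≤
          P.homNormInf (-s) f :=
        le_iSup (fun q : ℤ => ENNReal.ofReal ((2 : ℝ) ^ ((q : ℝ) * -s)) * l2norm (P.block q f)) q
      calc l2norm (P.block q f)
          = ENNReal.ofReal ((2 : ℝ) ^ (-(s * |(q : ℝ)|))) *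
            (ENNReal.ofReal ((2 : ℝ) ^ ((q : ℝ) * -s)) * l2norm (P.block q f)) := by
            rw [← mul_assoc, ← ENNReal.ofReal_mul (by positivity), ← Real.rpow_add (by norm_num),
              abs_of_nonpos hq]
            ring_nf
            simp
        _ ≤ _ := by gcongr
  refine ne_top_of_le_ne_top ?_ (ENNReal.tsum_le_tsum hterm)
  rw [ENNReal.tsum_add, ENNReal.tsum_mul_right,
    ← ENNReal.ofReal_tsum_of_nonneg (fun q => by positivity) (summable_two_rpow_neg_abs hs)]
  exact ENNReal.add_ne_top.mpr ⟨h₁, ENNReal.mul_ne_top ENNReal.ofReal_ne_top h₂⟩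

/-- A realized distribution with absolutely summable dyadic blocks is square integrable. -/
theorem LPPair.IsRealized.l2norm_ne_top {P : LPPair n} {f : TDist n} (hf : P.IsRealized f)
    (h : ∑' q : ℤ, l2norm (P.block q f) ≠ ⊤) : l2norm f ≠ ⊤ := by
  have hex : ∀ q : ℤ, ∃ g : Lp ℂ 2 (volume : Measure (Rn n)), (g : TDist n) = P.block q f :=
    fun q => by
      by_contra hne
      push Not at hne
      exact ENNReal.ne_top_of_tsum_ne_top h q (by simp [l2norm, hne])
  choose g hg using hex
  have hsum : Summable g := by
    refine Summable.of_nnnorm (ENNReal.tsum_coe_ne_top_iff_summable.mp ?_)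
    simp only [← hg, l2norm_coe] at h
    exact h
  obtain ⟨G, hG⟩ := hsum
  have h1 := hG.mapL (Lp.toTemperedDistributionCLM ℂ (volume : Measure (Rn n)) 2)
  have h2 := h1.comp (Finset.tendsto_Icc_neg (R := ℤ))
  have h3 : f = (G : TDist n) := by
    refine tendsto_nhds_unique hf (h2.congr fun N => ?_)
    exact Finset.sum_congr rfl fun q _ => hg q
  rw [h3, l2norm_coe]
  exact enorm_ne_top

/-- If the vector of the data is square integrable, its evolution is given by the exponential of the
symbol. -/
theorem IsMGTSolution.hasL2Fourier_mgtVector {τ β : ℝ} (hτ : 0 < τ) (hβ : τ < β)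
    {u₀ u₁ u₂ : TDist n} {u v w : ℝ → TDist n} (hsol : IsMGTSolution τ β u₀ u₁ u₂ u v w)
    {F : VIdx n → Rn n → ℂ} (hF : ∀ j, HasL2Fourier (mgtVector τ u₀ u₁ u₂ j) (F j))
    {t : ℝ} (ht : 0 ≤ t) (i : VIdx n) :
    HasL2Fourier (mgtVector τ (u t) (v t) (w t) i) fun ξ =>
      ∑ j, NormedSpace.exp (t • mgtSymbol τ β ((2 * Real.pi) • ξ)) i j * F j ξ := by
  obtain ⟨C, δ, hC, hδ, hexp⟩ := exists_norm_exp_mgtSymbol_le hτ hβ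
  set G : Rn n → ℂ := fun ξ =>
    ∑ j, NormedSpace.exp (t • mgtSymbol τ β ((2 * Real.pi) • ξ)) i j * F j ξ with hGdef
  have hG : MemLp G 2 volume := by
    refine memLp_finsetSum _ fun j _ => (hF j).1.of_le_mul (c := C)
      ((Matrix.continuous_exp_smul_apply (fun i j => (hasTemperateGrowth_mgtSymbol τ β i
        j).1.continuous) t i j).aestronglyMeasurable.mul (hF j).1.1)
      (Eventually.of_forall fun ξ => ?_)
    rw [norm_mul]
    gcongr
    refine (hexp n _ t ht i j).trans (mul_le_of_le_one_right hC.le (Real.exp_le_one_iff.mpr ?_))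
    rw [Left.neg_nonpos_iff]
    positivity
  refine ⟨hG, fun ψ => ?_⟩
  let b : ContDiffBump (0 : Rn n) := ⟨1, 2, by norm_num, by norm_num⟩
  set κ : Rn n → ℂ := fun x => (b x : ℂ) with hκdef
  have hκ : ContDiff ℝ ∞ κ := Complex.ofRealCLM.contDiff.comp b.contDiff
  have hκc : HasCompactSupport κ := b.hasCompactSupport.comp_left Complex.ofReal_zero
  have hκ1 : ∀ x, ‖x‖ < 1 → κ x = 1 := fun x hx => by
    have : b x = 1 := b.one_of_mem_closedBall (by simpa [b] using hx.le)
    simp [hκdef, this]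
  have hκle : ∀ x, ‖κ x‖ ≤ 1 := fun x => by
    rw [hκdef, Complex.norm_real, Real.norm_of_nonneg b.nonneg]
    exact b.le_one
  have hκN : ∀ N : ℕ, ContDiff ℝ ∞ fun x : Rn n => κ (((N : ℝ) + 1)⁻¹ • x) := fun N =>
    hκ.comp (contDiff_const_smul _)
  have hκNc : ∀ N : ℕ, HasCompactSupport fun x : Rn n => κ (((N : ℝ) + 1)⁻¹ • x) := fun N =>
    hκc.comp_smul (by positivity)
  have hκNt := fun N => (hκNc N).hasTemperateGrowth (hκN N)
  have hflow : ∀ N : ℕ, (𝓕 (mgtVector τ (u t) (v t) (w t) i) : TDist n)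
      (SchwartzMap.smulLeftCLM ℂ (fun x => κ (((N : ℝ) + 1)⁻¹ • x)) ψ) =
        ∫ ξ, κ (((N : ℝ) + 1)⁻¹ • ξ) * (ψ ξ * G ξ) := fun N => by
    rw [flow_eq_integral_exp
      (B := fun ξ => mgtSymbol τ β ((2 * Real.pi) • ξ))
      (X := fun i t => 𝓕 (mgtVector τ (u t) (v t) (w t) i))
      (h := fun j ξ => κ (((N : ℝ) + 1)⁻¹ • ξ) * F j ξ) (hasTemperateGrowth_mgtSymbol τ β)
      hsol.continuousOn_fourier_mgtVector (hsol.hasDerivAt_fourier_mgtVector hτ.ne') (hκNt N)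
      (hκNc N) (subset_tsupport _) (fun j => ?_) (fun j => Eventually.of_forall fun ξ hξ => ?_)
      (fun j ψ => ?_) ht i ψ]
    · refine integral_congr_ae (Eventually.of_forall fun ξ => ?_)
      simp only [hGdef, Finset.mul_sum]
      exact Finset.sum_congr rfl fun j _ => by ring
    · exact ((hκN N).continuous.memLp_of_hasCompactSupport (p := 2) (hκNc N)).integrable_mul
        (hF j).1
    · simp only [image_eq_zero_of_notMem_tsupport hξ, zero_mul]
    · rw [hsol.init_u, hsol.init_v, hsol.init_w, (hF j).2]
      refine integral_congr_ae (Eventually.of_forall fun ξ => ?_)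
      simp only [SchwartzMap.smulLeftCLM_apply_apply (hκNt N), smul_eq_mul]
      ring
  have hint : Integrable fun ξ => ψ ξ * G ξ := (ψ.memLp 2).integrable_mul hG
  have hlim1 := ((𝓕 (mgtVector τ (u t) (v t) (w t) i) : TDist n).continuous.tendsto ψ).comp
    (SchwartzMap.tendsto_smulLeftCLM_cutoff hκ hκc hκ1 ψ)
  refine tendsto_nhds_unique hlim1 ?_
  refine Tendsto.congr (fun N => (hflow N).symm) ?_
  refine tendsto_integral_of_dominated_convergence (fun ξ => ‖ψ ξ * G ξ‖)
    (fun N => (hκN N).continuous.aestronglyMeasurable.mul hint.1) hint.norm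
    (fun N => Eventually.of_forall fun ξ => ?_) (Eventually.of_forall fun ξ => ?_)
  · rw [norm_mul]
    exact mul_le_of_le_one_left (norm_nonneg _) (hκle _)
  · have hsmall : Tendsto (fun N : ℕ => ((N : ℝ) + 1)⁻¹ • ξ) atTop (𝓝 0) := by
      have h := tendsto_one_div_add_atTop_nhds_zero_nat (𝕜 := ℝ)
      simpa using h.smul_const ξ
    have hev : ∀ᶠ N : ℕ in atTop, κ (((N : ℝ) + 1)⁻¹ • ξ) = 1 := by
      have h0 : ‖(0 : Rn n)‖ < 1 := by simp
      filter_upwards [hsmall.norm.eventually_lt_const h0] with N hN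
      exact hκ1 _ hN
    refine tendsto_const_nhds.congr' ?_
    filter_upwards [hev] with N hN
    rw [hN, one_mul]

/-- The `L²` norm of a function is at most the sum of those of its dyadic pieces. -/
theorem LPPair.eLpNorm_le_tsum (P : LPPair n) (hn : 0 < n) {H : Rn n → ℂ}
    (hH : AEStronglyMeasurable H volume) :
    eLpNorm H 2 volume ≤ ∑' q : ℤ,
      eLpNorm (fun ξ => scaledSymbol (fun θ => P.φ ((2 : ℝ) ^ (-q) • θ)) ξ * H ξ) 2 volume := by
  have hmeas : ∀ q : ℤ, AEStronglyMeasurable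
      (fun ξ => scaledSymbol (fun θ => P.φ ((2 : ℝ) ^ (-q) • θ)) ξ * H ξ) volume := fun q =>
    (contDiff_scaledSymbol (P.contDiff_dilate q)).continuous.aestronglyMeasurable.mul hH
  have : Nonempty (Fin n) := ⟨⟨0, hn⟩⟩
  have hne : ∀ᵐ ξ : Rn n, ξ ≠ 0 := Measure.ae_ne _ _
  refine (Lp.eLpNorm_lim_le_liminf_eLpNorm (f := fun N : ℕ => ∑ q ∈ Finset.Icc (-(N : ℤ)) N,
    fun ξ => scaledSymbol (fun θ => P.φ ((2 : ℝ) ^ (-q) • θ)) ξ * H ξ)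
    (fun N => Finset.aestronglyMeasurable_sum _ fun q _ => hmeas q) H ?_).trans ?_
  · filter_upwards [hne] with ξ hξ
    have h1 := (P.sum_hom ((2 * Real.pi) • ξ) (smul_ne_zero (by positivity) hξ)).mapL
      Complex.ofRealCLM
    have h2 := (h1.mul_right (H ξ)).comp (Finset.tendsto_Icc_neg (R := ℤ))
    simpa [Function.comp_def, scaledSymbol] using h2
  · refine (liminf_le_liminf (v := fun _ => ∑' q : ℤ,
      eLpNorm (fun ξ => scaledSymbol (fun θ => P.φ ((2 : ℝ) ^ (-q) • θ)) ξ * H ξ) 2 volume)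
      (Eventually.of_forall fun N => ?_)).trans (liminf_const _).le
    exact (eLpNorm_sum_le (fun q _ => hmeas q) (by norm_num)).trans (ENNReal.sum_le_tsum _)

theorem LPPair.eLpNorm_norm_rpow_mul_le (P : LPPair n) {k : ℝ} (hk : 0 ≤ k) (q : ℤ)
    {f : TDist n} {G : Rn n → ℂ} (hG : HasL2Fourier f G) :
    eLpNorm (fun ξ => scaledSymbol (fun θ => P.φ ((2 : ℝ) ^ (-q) • θ)) ξ *
        (((‖(2 * Real.pi) • ξ‖ ^ k : ℝ) : ℂ) * G ξ)) 2 volume ≤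
      ENNReal.ofReal ((8 / 3) ^ k * (2 : ℝ) ^ ((q : ℝ) * k)) * l2norm (P.block q f) := by
  have hb := HasL2Fourier.multD
    (hasTemperateGrowth_scaledSymbol (P.contDiff_dilate q) (P.support_dilate_subset q)).1
    (fun θ => P.abs_φ_le _) hG
  rw [LPPair.block, hb.l2norm_eq]
  refine eLpNorm_le_mul_eLpNorm_of_ae_le_mul (Eventually.of_forall fun ξ => ?_) 2
  rw [mul_left_comm, norm_mul, Complex.norm_real, Real.norm_of_nonneg (by positivity)]
  by_cases h0 : scaledSymbol (fun θ => P.φ ((2 : ℝ) ^ (-q) • θ)) ξ = 0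
  · rw [h0]
    simp
  · gcongr
    have h2 := (P.support_dilate_subset q (a := (2 * Real.pi) • ξ)
      fun h => h0 (by simpa [scaledSymbol] using h)).2
    rw [two_rpow_intCast_mul, ← Real.mul_rpow (by norm_num) (by positivity)]
    exact Real.rpow_le_rpow (norm_nonneg _) h2 hk

/-- Fractional derivatives of order `k ∈ [0, σ]` of a square integrable distribution, in the
inhomogeneous space of regularity `σ - k`. -/
theorem LPPair.exists_isLambdaPow_normOne_le (P : LPPair n) (hn : 0 < n) {σ k : ℝ} (hk : 0 ≤ k)
    (hkσ : k ≤ σ) {f : TDist n} {G : Rn n → ℂ} (hG : HasL2Fourier f G)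
    (hfin : ∑' q : ℤ, ENNReal.ofReal ((2 : ℝ) ^ ((q : ℝ) * if 0 ≤ q then σ else k)) *
      l2norm (P.block q f) ≠ ⊤) :
    ∃ g : TDist n, IsLambdaPow k f g ∧ P.normOne (σ - k) g ≤
      ENNReal.ofReal (2 * (8 / 3) ^ σ) * ∑' q : ℤ,
        ENNReal.ofReal ((2 : ℝ) ^ ((q : ℝ) * if 0 ≤ q then σ else k)) * l2norm (P.block q f) := by
  set S := ∑' q : ℤ, ENNReal.ofReal ((2 : ℝ) ^ ((q : ℝ) * if 0 ≤ q then σ else k)) *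
    l2norm (P.block q f) with hS
  set H : Rn n → ℂ := fun ξ => ((‖(2 * Real.pi) • ξ‖ ^ k : ℝ) : ℂ) * G ξ with hHdef
  have hHm : AEStronglyMeasurable H volume := by
    have hc : Continuous fun ξ : Rn n => ((‖(2 * Real.pi) • ξ‖ ^ k : ℝ) : ℂ) :=
      Complex.continuous_ofReal.comp
        (((continuous_const_smul (2 * Real.pi)).norm).rpow_const fun _ => Or.inr hk)
    exact hc.aestronglyMeasurable.mul hG.1.1
  have h83 : ((8 : ℝ) / 3) ^ k ≤ (8 / 3) ^ σ :=
    Real.rpow_le_rpow_of_exponent_le (by norm_num) hkσ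
  have hpiece := fun q => P.eLpNorm_norm_rpow_mul_le hk q hG
  have hH : eLpNorm H 2 volume ≤ ENNReal.ofReal ((8 / 3) ^ σ) * S := by
    refine (P.eLpNorm_le_tsum hn hHm).trans ?_
    rw [hS, ← ENNReal.tsum_mul_left]
    refine ENNReal.tsum_le_tsum fun q => (hpiece q).trans ?_
    rw [← mul_assoc, ← ENNReal.ofReal_mul (by positivity)]
    gcongr ENNReal.ofReal (?_ * ?_) * _
    refine Real.rpow_le_rpow_of_exponent_le (by norm_num) ?_
    split_ifs with h0
    · have : (0 : ℝ) ≤ q := by exact_mod_cast h0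
      gcongr
    · exact le_rfl
  have hHL : MemLp H 2 volume := ⟨hHm, hH.trans_lt (ENNReal.mul_lt_top ENNReal.ofReal_lt_top
    hfin.lt_top)⟩
  obtain ⟨g, hg⟩ := exists_hasL2Fourier_of_memLp hHL
  refine ⟨g, ⟨G, fun ψ => ⟨⟨(ψ.memLp 2).integrable_mul hG.1, hG.2 ψ⟩,
    (ψ.memLp 2).integrable_mul hHL, hg.2 ψ⟩⟩, ?_⟩
  have hlow : l2norm (P.lowBlock g) ≤ eLpNorm H 2 volume := by
    have hχ : Function.support P.χ ⊆ {θ | 0 ≤ ‖θ‖ ∧ ‖θ‖ ≤ 4 / 3} := fun θ hθ =>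
      ⟨norm_nonneg θ, P.χ_supp hθ⟩
    have hχ1 : ∀ θ, |P.χ θ| ≤ 1 := fun θ =>
      abs_le.mpr ⟨by linarith [(P.χ_mem θ).1], (P.χ_mem θ).2⟩
    have hb := HasL2Fourier.multD (hasTemperateGrowth_scaledSymbol P.χ_smooth hχ).1 hχ1 hg
    rw [LPPair.lowBlock, hb.l2norm_eq]
    refine eLpNorm_mono fun ξ => ?_
    rw [norm_mul, scaledSymbol, Complex.norm_real]
    exact mul_le_of_le_one_left (norm_nonneg _) (hχ1 _)
  have hhigh : ∀ q : ℕ, ENNReal.ofReal ((2 : ℝ) ^ ((q : ℝ) * (σ - k))) *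
      l2norm (P.block (q : ℤ) g) ≤ ENNReal.ofReal ((8 / 3) ^ σ) *
        (ENNReal.ofReal ((2 : ℝ) ^ (((q : ℤ) : ℝ) * if 0 ≤ (q : ℤ) then σ else k)) *
          l2norm (P.block (q : ℤ) f)) := fun q => by
    have hb := HasL2Fourier.multD
      (hasTemperateGrowth_scaledSymbol (P.contDiff_dilate q) (P.support_dilate_subset q)).1
      (fun θ => P.abs_φ_le _) hg
    have h1 : l2norm (P.block (q : ℤ) g) ≤ _ := (hb.l2norm_eq.trans_le (hpiece q))
    refine (mul_le_mul_right h1 _).trans ?_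
    rw [← mul_assoc, ← mul_assoc, ← ENNReal.ofReal_mul (by positivity),
      ← ENNReal.ofReal_mul (by positivity), if_pos (by positivity), mul_left_comm,
      ← Real.rpow_add (by norm_num)]
    gcongr ENNReal.ofReal (?_ * ?_) * _
    refine le_of_eq ?_
    push_cast
    ring_nf
  have h2 : ENNReal.ofReal ((2 : ℝ) ^ (-(σ - k))) ≤ 1 := by
    rw [← ENNReal.ofReal_one]
    exact ENNReal.ofReal_le_ofReal
      (Real.rpow_le_one_of_one_le_of_nonpos (by norm_num) (by linarith))
  calc P.normOne (σ - k) g ≤ 1 * (ENNReal.ofReal ((8 / 3) ^ σ) * S) +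
        ENNReal.ofReal ((8 / 3) ^ σ) * S := by
        refine add_le_add (mul_le_mul' h2 (hlow.trans hH)) ?_
        refine (ENNReal.tsum_le_tsum hhigh).trans ?_
        rw [ENNReal.tsum_mul_left]
        exact mul_le_mul_right (ENNReal.tsum_comp_le_tsum_of_injective Nat.cast_injective
          fun q : ℤ => ENNReal.ofReal ((2 : ℝ) ^ ((q : ℝ) * if 0 ≤ q then σ else k)) *
            l2norm (P.block q f)) _
    _ = _ := by
        rw [one_mul, ← two_mul, ENNReal.ofReal_mul (by norm_num), ENNReal.ofReal_ofNat, mul_assoc]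

end LowFrequencies

end

theorem theorem5p1 (n : ℕ) (hn : 0 < n) (τ β : ℝ) (hτ : 0 < τ) (hβ : τ < β)
    (P : LPPair n) (σ s : ℝ) :
    (0 < σ + s →
      ∃ C : ℝ, 0 < C ∧
        ∀ (u₀ u₁ u₂ : TDist n) (u v w : ℝ → TDist n),
          IsMGTSolution τ β u₀ u₁ u₂ u v w →
          P.dataNorm σ s (mgtVector τ u₀ u₁ u₂) < ⊤ →
          ∀ t : ℝ, 0 ≤ t →
            ∑ i, P.homNormOne σ (mgtVector τ (u t) (v t) (w t) i) ≤
              ENNReal.ofReal (C * (1 + t) ^ (-((σ + s) / 2))) *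
                P.dataNorm σ s (mgtVector τ u₀ u₁ u₂)) ∧
    (0 ≤ σ → 0 < s →
      ∃ C : ℝ, 0 < C ∧
        ∀ (u₀ u₁ u₂ : TDist n) (u v w : ℝ → TDist n),
          IsMGTSolution τ β u₀ u₁ u₂ u v w →
          P.dataNorm σ s (mgtVector τ u₀ u₁ u₂) < ⊤ →
          (∀ i, P.IsRealized (mgtVector τ u₀ u₁ u₂ i)) →
          ∀ k : ℝ, 0 ≤ k → k ≤ σ → ∀ t : ℝ, 0 ≤ t →
            ∃ W : VIdx n → TDist n,
              (∀ i, IsLambdaPow k (mgtVector τ (u t) (v t) (w t) i) (W i)) ∧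
              ∑ i, P.normOne (σ - k) (W i) ≤
                ENNReal.ofReal (C * (1 + t) ^ (-((k + s) / 2))) *
                  P.dataNorm σ s (mgtVector τ u₀ u₁ u₂)) := by
  have hN : (0 : ℝ) < Fintype.card (VIdx n) := by
    exact_mod_cast (Fintype.card_pos : 0 < Fintype.card (VIdx n))
  have hcard : ∀ (f : VIdx n → ℝ≥0∞) (A : ℝ) (D : ℝ≥0∞), (∀ i, f i ≤ ENNReal.ofReal A * D) →
      ∑ i, f i ≤ ENNReal.ofReal (Fintype.card (VIdx n) * A) * D := fun f A D h => by
    refine (Finset.sum_le_sum fun i _ => h i).trans ?_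
    rw [Finset.sum_const, Finset.card_univ, nsmul_eq_mul, ENNReal.ofReal_mul hN.le,
      ENNReal.ofReal_natCast, mul_assoc]
  refine ⟨fun hσs => ?_, fun hσ hs => ?_⟩
  · obtain ⟨C, hC, h⟩ := P.exists_tsum_l2norm_block_mgtVector_le hτ hβ σ hσs
    refine ⟨Fintype.card (VIdx n) * C, by positivity, fun u₀ u₁ u₂ u v w hsol _ t ht => ?_⟩
    rw [mul_assoc]
    refine hcard _ _ _ fun i => ?_
    simpa [LPPair.homNormOne] using h u₀ u₁ u₂ u v w hsol σ le_rfl le_rfl t ht i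
  · obtain ⟨C, hC, h⟩ := P.exists_tsum_l2norm_block_mgtVector_le hτ hβ σ (k₀ := 0) (s := s)
      (by linarith)
    refine ⟨Fintype.card (VIdx n) * (2 * (8 / 3) ^ σ * C), by positivity,
      fun u₀ u₁ u₂ u v w hsol hD hreal k hk hkσ t ht => ?_⟩
    have hL2 : ∀ j, ∃ F, HasL2Fourier (mgtVector τ u₀ u₁ u₂ j) F := fun j => by
      obtain ⟨h₁, h₂⟩ := ENNReal.add_lt_top.mp hD
      exact exists_hasL2Fourier ((hreal j).l2norm_ne_top (P.tsum_l2norm_block_ne_top hσ hs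
        (ENNReal.sum_lt_top.mp h₁ j (Finset.mem_univ j)).ne
        (ENNReal.sum_lt_top.mp h₂ j (Finset.mem_univ j)).ne))
    choose F hF using hL2
    have hbound := fun i => h u₀ u₁ u₂ u v w hsol k hk hkσ t ht i
    choose W hΛ hW using fun i => P.exists_isLambdaPow_normOne_le hn hk hkσ
      (hsol.hasL2Fourier_mgtVector hτ hβ hF ht i)
      (ne_top_of_le_ne_top (ENNReal.mul_ne_top ENNReal.ofReal_ne_top hD.ne) (hbound i))
    refine ⟨W, hΛ, ?_⟩
    rw [mul_assoc]
    refine hcard _ _ _ fun i => (hW i).trans ?_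
    rw [mul_assoc _ C, ENNReal.ofReal_mul (p := 2 * (8 / 3) ^ σ) (by positivity),
      mul_assoc (ENNReal.ofReal (2 * (8 / 3) ^ σ)) (ENNReal.ofReal _)]
    exact mul_le_mul_right (hbound i) _
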